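/- For $n\ge 0$, the standard $n$-cube is the graph whose vertices are the subsets of $[n]=\{1,\dots,n\}$, two of them being adjacent if and only if they differ in exactly one element. A face is the subgraph induced by a set $\{V : I\subseteq V\subseteq J\}$ with $I\subseteq J\subseteq[n]$; it is proper if $(I,J)\neq(\emptyset,[n])$. An orientation of the cube chooses exactly one direction for every edge. A sink of a face is a vertex of the face from which no edge of the face is outgoing. A pseudo unique sink orientation (PUSO) of the standard $n$-cube is an orientation such that the cube itself does not have exactly one sink, while every proper face has exactly one sink. Let $\mathrm{puso}(n)$ denote the number of PUSOs of the standard $n$-cube (not up to isomorphism). Theorem (Counting PUSOs). (i) For $n\ge 2$, $\mathrm{puso}(n)\le 2^{2^{n-1}}$. (ii) For $n\ge 6$, $\mathrm{puso}(n) < 1.777128^{2^{n-1}}$. (iii) For $n=2^k$ with $k\ge 2$, $\mathrm{puso}(n)\ge 2^{2^{n-1-\log_2 n}+1}$. -/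

import Mathlib

/-- `φ V` is the set of outgoing coordinates of the vertex `V`. Vertices of the standard `n`-cube
are the subsets of the coordinate set `Fin n`, and `V` and `V ∆ {i}` are joined by the edge in
coordinate `i`. The map `φ` is (the outmap of) an orientation of the cube if, for every edge, the
coordinate of that edge is outgoing at exactly one of its two end points. -/
def IsOrientation {n : ℕ} (φ : Finset (Fin n) → Finset (Fin n)) : Prop :=
  ∀ (V : Finset (Fin n)) (i : Fin n), i ∈ symmDiff (φ V) (φ (symmDiff V {i}))

/-- `V` is a sink of the face with vertex set `{V | I ⊆ V ⊆ J}` and carrier `J \ I`: it is a vertex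
of the face, and no coordinate of the face is outgoing at `V`. -/
def IsFaceSink {n : ℕ} (φ : Finset (Fin n) → Finset (Fin n)) (I J V : Finset (Fin n)) : Prop :=
  I ⊆ V ∧ V ⊆ J ∧ φ V ∩ (J \ I) = ∅

/-- The face `{V | I ⊆ V ⊆ J}` has exactly one sink. -/
def HasUniqueSink {n : ℕ} (φ : Finset (Fin n) → Finset (Fin n)) (I J : Finset (Fin n)) : Prop :=
  ∃! V : Finset (Fin n), IsFaceSink φ I J V

/-- A pseudo unique sink orientation of the standard `n`-cube: an orientation such that the cube
itself does not have a unique sink, but every proper face has one. -/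
def IsPUSO {n : ℕ} (φ : Finset (Fin n) → Finset (Fin n)) : Prop :=
  IsOrientation φ ∧
  ¬ HasUniqueSink φ ∅ Finset.univ ∧
  ∀ I J : Finset (Fin n), I ⊆ J → ¬ (I = ∅ ∧ J = Finset.univ) → HasUniqueSink φ I J

/-- The number of pseudo unique sink orientations of the standard `n`-cube. -/
noncomputable def puso (n : ℕ) : ℕ :=
  Nat.card {φ : Finset (Fin n) → Finset (Fin n) // IsPUSO φ}

/-!
The count rests on a duality. Flipping all edges of one coordinate preserves pseudo unique sink
orientations (`IsPUSO.flip`), so every statement about sinks is a statement about arbitrary outmap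
values. It follows that antipodal vertices have the same outmap, that other pairs of vertices
satisfy the Szabó–Welzl condition, and that the outmap values are exactly the sets of one parity
(`IsPUSO.apply_compl`, `IsPUSO.not_disjoint`, `IsPUSO.exists_parity`). Up to the parity, a pseudo
unique sink orientation of the `(m + 1)`-cube is therefore a bijection from antipodal pairs to
subsets of an `m`-set; the inverses of these bijections are the outmaps of the odd unique sink
orientations of the `m`-cube (`IsOddUSO`), in which vertices with complementary outmaps in their
common face have odd distance. Both directions of the duality come from
`parityLift_antipodalRep_iff`.

In each `2`-face an odd unique sink orientation looks like the Klee–Minty orientation, up to an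
even number of flips. So the difference to the Klee–Minty orientation is a closed cochain modulo
`2`, hence the coboundary of a Boolean function `F` on the `m`-cube, unique up to a constant that
can be used to store the parity (`IsOddUSO.exists_potentialOutmap_eq`). There are `2 ^ 2 ^ m`
functions, which is the first bound.

For the second bound, restrict `F` to the `2 ^ (m - 5)` parallel `5`-faces of the `m`-cube. On
every `3`-face the Szabó–Welzl condition for antipodal vertices excludes one eighth of all
functions, and `64 * 1463832 = 93685248` functions on the `5`-cube, out of `2 ^ 32`, satisfy this
condition on all `40` of the `3`-faces. This number is less than `1.777128 ^ 32`. The condition is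
invariant under adding affine functions, which leaves `2 ^ 26` functions to test; the test is done
for `2 ^ 20` of them at a time, by bitwise operations on numbers that encode sets of functions
(`WordTree.solutions`).

For the third bound, let `F` be the indicator function of a set of minimum distance `3`: flipping
all edges at such vertices keeps the Klee–Minty orientation an odd unique sink orientation
(`isOddUSO_potentialOutmap_indicator`). The subsets of the perfect Hamming code, of size
`2 ^ (m - k)` for `m = 2 ^ k - 1`, give the required number of orientations, each with two parities.
-/

open Finset
open scoped symmDiff

/-! ### Flipping coordinates -/

/-- The sinks of a face are those of the sinks of its two facets in direction `a` at which `a` is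
not outgoing. -/
theorem isFaceSink_iff_of_facets {n : ℕ} {φ : Finset (Fin n) → Finset (Fin n)}
    {I J V₀ V₁ : Finset (Fin n)} {a : Fin n} (haI : a ∉ I) (haJ : a ∈ J)
    (h₀ : IsFaceSink φ I (J.erase a) V₀) (h₀' : ∀ V, IsFaceSink φ I (J.erase a) V → V = V₀)
    (h₁ : IsFaceSink φ (insert a I) J V₁) (h₁' : ∀ V, IsFaceSink φ (insert a I) J V → V = V₁)
    (V : Finset (Fin n)) :
    IsFaceSink φ I J V ↔ (V = V₀ ∧ a ∉ φ V₀) ∨ (V = V₁ ∧ a ∉ φ V₁) := by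
  have key : ∀ (P Q R : Finset (Fin n)), P ∩ (Q \ R) = ∅ ↔ ∀ i ∈ P, i ∈ Q → i ∈ R := by
    intro P Q R
    simp only [Finset.eq_empty_iff_forall_notMem, mem_inter, mem_sdiff, not_and, not_not]
  simp only [IsFaceSink, key] at *
  constructor
  · rintro ⟨hI, hJ, hs⟩
    have haV : a ∉ φ V := fun h => haI (hs a h haJ)
    by_cases ha : a ∈ V
    · right
      have : V = V₁ := h₁' V ⟨insert_subset ha hI, hJ, fun i hi hiJ =>
        mem_insert_of_mem (hs i hi hiJ)⟩
      exact ⟨this, this ▸ haV⟩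
    · left
      have : V = V₀ := h₀' V ⟨hI, fun i hi => mem_erase.2 ⟨fun h => ha (h ▸ hi), hJ hi⟩,
        fun i hi hiJ => hs i hi (mem_of_mem_erase hiJ)⟩
      exact ⟨this, this ▸ haV⟩
  · rintro (⟨rfl, ha⟩ | ⟨rfl, ha⟩)
    · refine ⟨h₀.1, h₀.2.1.trans (erase_subset _ _), fun i hi hiJ => h₀.2.2 i hi ?_⟩
      exact mem_erase.2 ⟨fun h => ha (h ▸ hi), hiJ⟩
    · refine ⟨(subset_insert _ _).trans h₁.1, h₁.2.1, fun i hi hiJ => ?_⟩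
      rcases mem_insert.1 (h₁.2.2 i hi hiJ) with h | h
      · exact absurd (h ▸ hi) ha
      · exact h

theorem isFaceSink_flip_of_notMem {n : ℕ} (φ : Finset (Fin n) → Finset (Fin n))
    {I J : Finset (Fin n)} {a : Fin n} (ha : a ∉ J \ I) (V : Finset (Fin n)) :
    IsFaceSink (fun V => φ V ∆ {a}) I J V ↔ IsFaceSink φ I J V := by
  have : (φ V ∆ {a}) ∩ (J \ I) = φ V ∩ (J \ I) := by
    ext i
    simp only [mem_inter, mem_symmDiff, mem_singleton, and_congr_left_iff]
    intro hi
    have : i ≠ a := fun h => ha (h ▸ hi)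
    simp [this]
  simp only [IsFaceSink, this]

/-- Flipping all edges of one coordinate does not affect whether a face has a unique sink, provided
its two facets in that direction have one: exactly one of the two facet sinks is a sink of the
face iff exactly one of them has the flipped coordinate outgoing. -/
theorem hasUniqueSink_flip_singleton {n : ℕ} (φ : Finset (Fin n) → Finset (Fin n))
    {I J : Finset (Fin n)} (a : Fin n)
    (h₀ : a ∈ J \ I → HasUniqueSink φ I (J.erase a))
    (h₁ : a ∈ J \ I → HasUniqueSink φ (insert a I) J) :
    HasUniqueSink (fun V => φ V ∆ {a}) I J ↔ HasUniqueSink φ I J := by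
  by_cases ha : a ∈ J \ I
  · obtain ⟨V₀, s₀, u₀⟩ := h₀ ha
    obtain ⟨V₁, s₁, u₁⟩ := h₁ ha
    obtain ⟨haJ, haI⟩ := mem_sdiff.1 ha
    have n₀ : a ∉ J.erase a \ I := by simp
    have n₁ : a ∉ J \ insert a I := by simp
    have hne : V₀ ≠ V₁ := by
      rintro rfl
      exact notMem_erase a J (s₀.2.1 (s₁.1 (mem_insert_self _ _)))
    have e := isFaceSink_iff_of_facets haI haJ s₀ u₀ s₁ u₁
    have e' := isFaceSink_iff_of_facets (φ := fun V => φ V ∆ {a}) haI haJ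
      ((isFaceSink_flip_of_notMem φ n₀ V₀).2 s₀)
      (fun V h => u₀ V ((isFaceSink_flip_of_notMem φ n₀ V).1 h))
      ((isFaceSink_flip_of_notMem φ n₁ V₁).2 s₁)
      (fun V h => u₁ V ((isFaceSink_flip_of_notMem φ n₁ V).1 h))
    have hx : ∀ P Q : Prop, (∃! V, (V = V₀ ∧ P) ∨ (V = V₁ ∧ Q)) ↔ ¬ (P ↔ Q) := by
      intro P Q
      by_cases hP : P <;> by_cases hQ : Q <;> simp only [hP, hQ, and_true, and_false, or_false,
        false_or, existsUnique_eq, iff_self, not_true, not_false_eq_true, iff_true, iff_false]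
      · rintro ⟨V, -, hu⟩
        exact hne ((hu V₀ (Or.inl rfl)).trans (hu V₁ (Or.inr rfl)).symm)
      · rintro ⟨V, h, -⟩
        exact h
    unfold HasUniqueSink
    simp only [e, e', hx]
    have hm : ∀ V, a ∉ φ V ∆ {a} ↔ a ∈ φ V := by
      intro V
      simp [mem_symmDiff]
    rw [hm, hm]
    tauto
  · unfold HasUniqueSink
    simp only [isFaceSink_flip_of_notMem φ ha]

theorem IsPUSO.flip_singleton {n : ℕ} {φ : Finset (Fin n) → Finset (Fin n)} (hφ : IsPUSO φ)
    (a : Fin n) : IsPUSO (fun V => φ V ∆ {a}) := by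
  obtain ⟨ho, hs, hp⟩ := hφ
  have key : ∀ I J : Finset (Fin n), I ⊆ J →
      (HasUniqueSink (fun V => φ V ∆ {a}) I J ↔ HasUniqueSink φ I J) := by
    intro I J hIJ
    refine hasUniqueSink_flip_singleton φ a (fun ha => hp _ _ ?_ ?_) (fun ha => hp _ _ ?_ ?_)
    · exact fun i hi => mem_erase.2 ⟨fun h => (mem_sdiff.1 ha).2 (h ▸ hi), hIJ hi⟩
    · rintro ⟨-, h⟩
      exact notMem_erase a J (h ▸ mem_univ a)
    · exact insert_subset (mem_sdiff.1 ha).1 hIJ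
    · rintro ⟨h, -⟩
      exact notMem_empty a (h ▸ mem_insert_self a I)
  refine ⟨fun V i => ?_, fun h => hs ((key _ _ (empty_subset _)).1 h),
    fun I J hIJ h => (key I J hIJ).2 (hp I J hIJ h)⟩
  have := ho V i
  simp only [mem_symmDiff] at this ⊢
  tauto

theorem IsPUSO.flip {n : ℕ} {φ : Finset (Fin n) → Finset (Fin n)} (hφ : IsPUSO φ)
    (Λ : Finset (Fin n)) : IsPUSO (fun V => φ V ∆ Λ) := by
  induction Λ using Finset.induction_on with
  | empty =>
    have e : ∀ V, φ V ∆ ∅ = φ V := fun V => symmDiff_bot _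
    simpa only [e] using hφ
  | insert a Λ ha ih =>
    have h := ih.flip_singleton a
    have e : ∀ V, (φ V ∆ Λ) ∆ {a} = φ V ∆ insert a Λ := by
      intro V
      rw [symmDiff_assoc]
      congr 1
      ext i
      simp only [mem_symmDiff, mem_singleton, mem_insert]
      by_cases hi : i = a
      · subst hi; simp [ha]
      · simp [hi]
    simpa only [e] using h

/-! ### The structure of pseudo unique sink orientations -/

/-- The Szabó–Welzl condition: two vertices that span a proper face differ in the orientation of
some coordinate of that face. -/
theorem IsPUSO.not_disjoint {n : ℕ} {φ : Finset (Fin n) → Finset (Fin n)} (hφ : IsPUSO φ)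
    {V W : Finset (Fin n)} (h : V ≠ W) (hc : V ≠ Wᶜ) : ¬ Disjoint (V ∆ W) (φ V ∆ φ W) := by
  intro hd
  have hp := (hφ.flip (φ V)).2.2 (V ∩ W) (V ∪ W) (inter_subset_left.trans subset_union_left) (by
    rintro ⟨h1, h2⟩
    exact hc (eq_compl_iff_isCompl.2
      ⟨Finset.disjoint_iff_inter_eq_empty.2 h1, codisjoint_iff.2 h2⟩))
  obtain ⟨U, -, hu⟩ := hp
  have e : (V ∪ W) \ (V ∩ W) = V ∆ W := (symmDiff_eq_sup_sdiff_inf V W).symm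
  refine h ((hu V ⟨inter_subset_left, subset_union_left, ?_⟩).trans
    (hu W ⟨inter_subset_right, subset_union_right, ?_⟩).symm)
  · simp
  · dsimp only
    rw [e, symmDiff_comm (φ W), inter_comm, ← Finset.disjoint_iff_inter_eq_empty]
    exact hd

theorem IsPUSO.apply_compl {n : ℕ} {φ : Finset (Fin n) → Finset (Fin n)} (hφ : IsPUSO φ)
    (V : Finset (Fin n)) : φ Vᶜ = φ V := by
  have hs := (hφ.flip (φ V)).2.1
  have hV : IsFaceSink (fun W => φ W ∆ φ V) ∅ univ V :=
    ⟨empty_subset _, subset_univ _, by simp⟩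
  obtain ⟨W, hW, hne⟩ : ∃ W, IsFaceSink (fun W => φ W ∆ φ V) ∅ univ W ∧ W ≠ V := by
    by_contra! hcon
    exact hs ⟨V, hV, hcon⟩
  have he : φ W = φ V := by simpa using hW.2.2
  by_cases hc : W = Vᶜ
  · rw [← hc, he]
  · exact absurd (by simp [he]) (hφ.not_disjoint hne hc)

theorem IsPUSO.eq_or_eq_compl {n : ℕ} {φ : Finset (Fin n) → Finset (Fin n)} (hφ : IsPUSO φ)
    {V W : Finset (Fin n)} (h : φ V = φ W) : V = W ∨ V = Wᶜ := by
  by_contra! hcon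
  exact hφ.not_disjoint hcon.1 hcon.2 (by simp [h])

/-- Exactly one of the sets `Λ` and `Λ ∪ {a}` is an outmap value. The unique vertex of the facet
`{V | a ∉ V}` whose outmap agrees with `Λ` outside `a` provides one; two would give, up to
complementation, two such vertices of that facet. -/
theorem IsPUSO.exists_apply_eq_insert_iff {n : ℕ} {φ : Finset (Fin n) → Finset (Fin n)}
    (hφ : IsPUSO φ) {Λ : Finset (Fin n)} {a : Fin n} (ha : a ∉ Λ) :
    (∃ V, φ V = insert a Λ) ↔ ¬ ∃ V, φ V = Λ := by
  obtain ⟨V₀, ⟨-, hV₀, hs⟩, hu⟩ := (hφ.flip Λ).2.2 ∅ (univ.erase a) (empty_subset _) (by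
    rintro ⟨-, h⟩
    have := mem_univ a
    rw [← h] at this
    exact notMem_erase a univ this)
  constructor
  · rintro ⟨V, hV⟩ ⟨W, hW⟩
    have red : ∀ U : Finset (Fin n), ∃ U', a ∉ U' ∧ φ U' = φ U := by
      intro U
      by_cases hU : a ∈ U
      · exact ⟨Uᶜ, by simpa using hU, hφ.apply_compl U⟩
      · exact ⟨U, hU, rfl⟩
    obtain ⟨V', hV', eV⟩ := red V
    obtain ⟨W', hW', eW⟩ := red W
    have e1 : V' = V₀ := by
      refine hu V' ⟨empty_subset _, fun i hi => mem_erase.2 ⟨fun h => hV' (h ▸ hi), mem_univ _⟩, ?_⟩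
      dsimp only
      rw [eV, hV]
      ext i
      by_cases hi : i = a <;> simp [mem_symmDiff, hi]
    have e2 : W' = V₀ := by
      refine hu W' ⟨empty_subset _, fun i hi => mem_erase.2 ⟨fun h => hW' (h ▸ hi), mem_univ _⟩, ?_⟩
      simp [eW, hW]
    have : insert a Λ = Λ := by rw [← hV, ← eV, e1, ← e2, eW, hW]
    exact ha (this ▸ mem_insert_self a Λ)
  · intro hno
    refine ⟨V₀, ?_⟩
    have hag : ∀ i, i ≠ a → (i ∈ φ V₀ ↔ i ∈ Λ) := by
      intro i hi
      have := Finset.eq_empty_iff_forall_notMem.1 hs i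
      simp only [mem_inter, mem_symmDiff, mem_sdiff, mem_erase, mem_univ, notMem_empty] at this
      tauto
    have haV : a ∈ φ V₀ := by
      by_contra hcon
      refine hno ⟨V₀, ?_⟩
      ext i
      by_cases hi : i = a
      · subst hi; simp [ha, hcon]
      · exact hag i hi
    ext i
    by_cases hi : i = a
    · subst hi; simp [haV]
    · simp [hi, hag i hi]

/-- The outmap values of a pseudo unique sink orientation are the sets of one parity. -/
theorem IsPUSO.exists_parity {n : ℕ} {φ : Finset (Fin n) → Finset (Fin n)} (hφ : IsPUSO φ) :
    ∃ p : Bool, ∀ Λ, (∃ V, φ V = Λ) ↔ (Odd #Λ ↔ p = true) := by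
  classical
  refine ⟨!decide (∃ V, φ V = ∅), fun Λ => ?_⟩
  induction Λ using Finset.induction_on with
  | empty => simp
  | insert a Λ ha ih =>
    rw [hφ.exists_apply_eq_insert_iff ha, ih, card_insert_of_notMem ha, Nat.odd_add_one]
    tauto

/-! ### Odd unique sink orientations and the dual of a pseudo unique sink orientation -/

/-- An odd unique sink orientation, given by its outmap `ψ`. The first condition is the Szabó–Welzl
criterion for unique sink orientations; the second one says that two vertices whose outmaps are
complementary on the face they span have odd distance. -/
def IsOddUSO {m : ℕ} (ψ : Finset (Fin m) → Finset (Fin m)) : Prop :=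
  ∀ X Y, X ≠ Y → ¬ Disjoint (X ∆ Y) (ψ X ∆ ψ Y) ∧ (X ∆ Y ⊆ ψ X ∆ ψ Y → Odd #(X ∆ Y))

theorem IsOddUSO.injective {m : ℕ} {ψ : Finset (Fin m) → Finset (Fin m)} (h : IsOddUSO ψ) :
    Function.Injective ψ := by
  intro X Y hXY
  by_contra hne
  exact (h X Y hne).1 (by simp [hXY])

/-- The representative of the antipodal pair `{V, Vᶜ}` that avoids the last coordinate, as a vertex
of the cube of one dimension less. -/
def antipodalRep {m : ℕ} (V : Finset (Fin (m + 1))) : Finset (Fin m) :=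
  {i | ¬ (i.castSucc ∈ V ↔ Fin.last m ∈ V)}

/-- The set with the same elements as `X` below the last coordinate whose cardinality is odd if
`p` is true and even otherwise. -/
def parityLift {m : ℕ} (p : Bool) (X : Finset (Fin m)) : Finset (Fin (m + 1)) :=
  X.map Fin.castSuccEmb ∪ if Odd #X ↔ p = true then ∅ else {Fin.last m}

section Dual

variable {m : ℕ} {p : Bool} {X Y : Finset (Fin m)} {V W : Finset (Fin (m + 1))}

@[simp] theorem mem_antipodalRep {i : Fin m} :
    i ∈ antipodalRep V ↔ ¬ (i.castSucc ∈ V ↔ Fin.last m ∈ V) := by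
  simp [antipodalRep]

@[simp] theorem castSucc_mem_parityLift {i : Fin m} : i.castSucc ∈ parityLift p X ↔ i ∈ X := by
  unfold parityLift
  split_ifs <;> simp

@[simp] theorem last_mem_parityLift :
    Fin.last m ∈ parityLift p X ↔ ¬ (Odd #X ↔ p = true) := by
  unfold parityLift
  split_ifs with h <;> simp [h]

theorem parityLift_injective : Function.Injective (parityLift (m := m) p) := by
  intro X Y h
  ext i
  rw [← castSucc_mem_parityLift (p := p), h, castSucc_mem_parityLift]

theorem odd_card_iff_castSucc (Λ : Finset (Fin (m + 1))) :
    Odd #Λ ↔ ¬ (Odd #{i : Fin m | i.castSucc ∈ Λ} ↔ Fin.last m ∈ Λ) := by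
  have h : #Λ = #{i : Fin m | i.castSucc ∈ Λ} + if Fin.last m ∈ Λ then 1 else 0 := by
    rw [card_filter, ← Fin.sum_univ_castSucc (fun i => if i ∈ Λ then 1 else 0), ← card_filter]
    congr 1
    ext i
    simp
  rw [h]
  split_ifs with hl <;> simp [hl, Nat.odd_add_one]

theorem odd_card_parityLift : Odd #(parityLift p X) ↔ p = true := by
  rw [odd_card_iff_castSucc]
  simp only [castSucc_mem_parityLift, Finset.filter_univ_mem, last_mem_parityLift]
  tauto

theorem exists_parityLift_eq {Λ : Finset (Fin (m + 1))} (h : Odd #Λ ↔ p = true) :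
    ∃ X, parityLift p X = Λ := by
  refine ⟨({i : Fin m | i.castSucc ∈ Λ} : Finset (Fin m)), ?_⟩
  rw [odd_card_iff_castSucc] at h
  ext i
  refine Fin.lastCases ?_ (fun i => ?_) i
  · rw [last_mem_parityLift]
    tauto
  · simp

theorem antipodalRep_compl (V : Finset (Fin (m + 1))) : antipodalRep Vᶜ = antipodalRep V := by
  ext i
  simp only [mem_antipodalRep, mem_compl]
  tauto

theorem antipodalRep_eq_iff : antipodalRep V = antipodalRep W ↔ V = W ∨ V = Wᶜ := by
  constructor
  · intro h
    have h' : ∀ i : Fin m,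
        (i.castSucc ∈ V ↔ Fin.last m ∈ V) ↔ (i.castSucc ∈ W ↔ Fin.last m ∈ W) := by
      intro i
      have := Finset.ext_iff.1 h i
      simp only [mem_antipodalRep] at this
      tauto
    by_cases hl : Fin.last m ∈ V ↔ Fin.last m ∈ W
    · left
      ext i
      refine Fin.lastCases hl (fun i => ?_) i
      have := h' i
      tauto
    · right
      ext i
      rw [mem_compl]
      refine Fin.lastCases (by tauto) (fun i => ?_) i
      have := h' i
      tauto
  · rintro (rfl | rfl)
    · rfl
    · exact antipodalRep_compl W

theorem odd_card_symmDiff {α : Type*} [DecidableEq α] (X Y : Finset α) :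
    Odd #(X ∆ Y) ↔ ¬ (Odd #X ↔ Odd #Y) := by
  have h1 : #(X ∆ Y) = #(X \ Y) + #(Y \ X) :=
    card_union_of_disjoint disjoint_sdiff_sdiff
  have h2 := card_sdiff_add_card_inter X Y
  have h3 := card_sdiff_add_card_inter Y X
  rw [inter_comm] at h3
  rw [h1, ← h2, ← h3]
  simp only [Nat.odd_add, ← Nat.not_odd_iff_even]
  tauto

/-- The translation between the two sides of the duality: outmap values `parityLift p X`,
`parityLift p Y` at `V`, `W` satisfy the Szabó–Welzl condition for both `V, W` and `V, Wᶜ` if and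
only if the vertices `X`, `Y` with outmaps `antipodalRep V`, `antipodalRep W` satisfy the
conditions of an odd unique sink orientation. -/
theorem parityLift_antipodalRep_iff :
    (¬ Disjoint (V ∆ W) (parityLift p X ∆ parityLift p Y) ∧
      ¬ Disjoint (V ∆ Wᶜ) (parityLift p X ∆ parityLift p Y)) ↔
    (¬ Disjoint (X ∆ Y) (antipodalRep V ∆ antipodalRep W) ∧
      (X ∆ Y ⊆ antipodalRep V ∆ antipodalRep W → Odd #(X ∆ Y))) := by
  have hc : ∀ i : Fin m, i.castSucc ∈ parityLift p X ∆ parityLift p Y ↔ i ∈ X ∆ Y := by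
    simp [mem_symmDiff]
  have hl : Fin.last m ∈ parityLift p X ∆ parityLift p Y ↔ Odd #(X ∆ Y) := by
    rw [odd_card_symmDiff]
    simp only [mem_symmDiff, last_mem_parityLift]
    tauto
  have hr : ∀ i : Fin m, i ∈ antipodalRep V ∆ antipodalRep W ↔
      ¬ (i.castSucc ∈ V ∆ W ↔ Fin.last m ∈ V ∆ W) := by
    intro i
    simp only [mem_symmDiff, mem_antipodalRep]
    by_cases h1 : i.castSucc ∈ V <;> by_cases h2 : i.castSucc ∈ W <;>
      by_cases h3 : Fin.last m ∈ V <;> by_cases h4 : Fin.last m ∈ W <;> simp [h1, h2, h3, h4]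
  have hcompl : ∀ i, i ∈ V ∆ Wᶜ ↔ i ∉ V ∆ W := by
    intro i
    simp only [mem_symmDiff, mem_compl]
    tauto
  simp only [not_disjoint_iff, Finset.subset_iff, Fin.exists_fin_succ', hc, hl, hr, hcompl]
  by_cases hlast : Fin.last m ∈ V ∆ W
  · simp only [hlast, true_and, not_true, iff_true, false_and, or_false]
    constructor
    · rintro ⟨h1, i, hi, hi'⟩
      refine ⟨⟨i, hi', hi⟩, fun hall => h1.resolve_left ?_⟩
      rintro ⟨j, hj, hj'⟩
      exact hall hj' hj
    · rintro ⟨⟨i, hi, hi'⟩, h⟩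
      refine ⟨?_, i, hi', hi⟩
      by_contra! hcon
      exact hcon.2 (h fun j hj hj' => hcon.1 j hj' hj)
  · simp only [hlast, false_and, or_false, iff_false, not_not, not_false_eq_true, true_and]
    constructor
    · rintro ⟨⟨i, hi, hi'⟩, h⟩
      refine ⟨⟨i, hi', hi⟩, fun hall => h.resolve_left ?_⟩
      rintro ⟨j, hj, hj'⟩
      exact hj (hall hj')
    · rintro ⟨⟨i, hi, hi'⟩, h⟩
      refine ⟨⟨i, hi', hi⟩, ?_⟩
      by_contra! hcon
      exact hcon.2 (h fun j hj => by_contra fun hj' => hcon.1 j hj' hj)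

end Dual

/-- Every pseudo unique sink orientation is dual to an odd unique sink orientation: the outmap of
the latter sends the lower part of an outmap value to the antipodal pair that has this value. -/
theorem IsPUSO.exists_oddUSO {m : ℕ} {φ : Finset (Fin (m + 1)) → Finset (Fin (m + 1))}
    (hφ : IsPUSO φ) :
    ∃ (p : Bool) (ψ : Finset (Fin m) → Finset (Fin m)), IsOddUSO ψ ∧
      ∀ V, ∃ X, φ V = parityLift p X ∧ antipodalRep V = ψ X := by
  obtain ⟨p, hp⟩ := hφ.exists_parity
  have hex : ∀ X : Finset (Fin m), ∃ V, φ V = parityLift p X := fun X =>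
    (hp _).2 odd_card_parityLift
  choose v hv using hex
  refine ⟨p, fun X => antipodalRep (v X), fun X Y hXY => ?_, fun V => ?_⟩
  · refine parityLift_antipodalRep_iff (p := p).1 ?_
    have hne : φ (v X) ≠ φ (v Y) := by
      rw [hv, hv]
      exact parityLift_injective.ne hXY
    have h1 : v X ≠ v Y := fun h => hne (h ▸ rfl)
    have h2 : v X ≠ (v Y)ᶜ := fun h => hne (by rw [h, hφ.apply_compl])
    rw [← hv, ← hv]
    refine ⟨hφ.not_disjoint h1 h2, ?_⟩
    rw [← hφ.apply_compl (v Y)]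
    exact hφ.not_disjoint h2 (by rwa [compl_compl])
  · obtain ⟨X, hX⟩ := exists_parityLift_eq ((hp (φ V)).1 ⟨V, rfl⟩)
    refine ⟨X, hX.symm, antipodalRep_eq_iff.2 (hφ.eq_or_eq_compl ?_)⟩
    rw [hv, hX]

/-- The Szabó–Welzl condition on a proper face makes the outmap a bijection from the face onto the
subsets of its carrier, so that exactly one vertex is mapped to the empty set. -/
theorem hasUniqueSink_of_not_disjoint {n : ℕ} {φ : Finset (Fin n) → Finset (Fin n)}
    (h : ∀ V W, V ≠ W → V ≠ Wᶜ → ¬ Disjoint (V ∆ W) (φ V ∆ φ W)) {I J : Finset (Fin n)}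
    (hIJ : I ⊆ J) (hp : ¬ (I = ∅ ∧ J = univ)) : HasUniqueSink φ I J := by
  have hinj : ∀ V ∈ Icc I J, ∀ W ∈ Icc I J, φ V ∩ (J \ I) = φ W ∩ (J \ I) → V = W := by
    intro V hV W hW he
    rw [mem_Icc] at hV hW
    by_contra hne
    refine h V W hne ?_ ?_
    · rintro rfl
      apply hp
      constructor
      · exact Finset.eq_empty_of_forall_notMem fun i hi => mem_compl.1 (hV.1 hi) (hW.1 hi)
      · refine Finset.eq_univ_of_forall fun i => ?_
        by_cases hi : i ∈ W
        · exact hW.2 hi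
        · exact hV.2 (mem_compl.2 hi)
    · rw [Finset.disjoint_left]
      intro i hi
      have hiK : i ∈ J \ I := by
        rcases mem_symmDiff.1 hi with ⟨h1, h2⟩ | ⟨h1, h2⟩
        · exact mem_sdiff.2 ⟨hV.2 h1, fun hI => h2 (hW.1 hI)⟩
        · exact mem_sdiff.2 ⟨hW.2 h1, fun hI => h2 (hV.1 hI)⟩
      have := Finset.ext_iff.1 he i
      simp only [mem_inter, hiK, and_true] at this
      simp [mem_symmDiff, this]
  obtain ⟨V, hV, hVs⟩ := Finset.surj_on_of_inj_on_of_card_le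
    (s := Icc I J) (t := (J \ I).powerset) (fun V _ => φ V ∩ (J \ I))
    (fun V _ => mem_powerset.2 inter_subset_right)
    (fun V W hV hW he => hinj V hV W hW he)
    (by rw [card_powerset, card_Icc_finset hIJ, card_sdiff_of_subset hIJ]) ∅
    (empty_mem_powerset _)
  refine ⟨V, ⟨(mem_Icc.1 hV).1, (mem_Icc.1 hV).2, hVs.symm⟩, fun W hW => ?_⟩
  exact hinj W (mem_Icc.2 ⟨hW.1, hW.2.1⟩) V hV (hW.2.2.trans hVs)

/-- The pseudo unique sink orientation with parity `p` dual to the odd unique sink orientation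
`ψ`. -/
noncomputable def dualPUSO {m : ℕ} (p : Bool) (ψ : Finset (Fin m) → Finset (Fin m))
    (V : Finset (Fin (m + 1))) : Finset (Fin (m + 1)) :=
  parityLift p (Function.invFun ψ (antipodalRep V))

theorem IsOddUSO.isPUSO_dualPUSO {m : ℕ} (hm : m ≠ 0) (p : Bool)
    {ψ : Finset (Fin m) → Finset (Fin m)} (hψ : IsOddUSO ψ) : IsPUSO (dualPUSO p ψ) := by
  have hsurj : Function.Surjective ψ := Finite.surjective_of_injective hψ.injective
  have hinv : ∀ V : Finset (Fin (m + 1)), ψ (Function.invFun ψ (antipodalRep V)) = antipodalRep V :=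
    fun V => Function.rightInverse_invFun hsurj _
  have hsw : ∀ V W, V ≠ W → V ≠ Wᶜ → ¬ Disjoint (V ∆ W) (dualPUSO p ψ V ∆ dualPUSO p ψ W) := by
    intro V W h1 h2
    have hne : Function.invFun ψ (antipodalRep V) ≠ Function.invFun ψ (antipodalRep W) := by
      intro h
      have := congrArg ψ h
      rw [hinv, hinv, antipodalRep_eq_iff] at this
      exact this.elim h1 h2
    have h := hψ _ _ hne
    rw [hinv, hinv] at h
    exact (parityLift_antipodalRep_iff.2 h).1
  have hcompl : ∀ V, dualPUSO p ψ Vᶜ = dualPUSO p ψ V := fun V => by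
    rw [dualPUSO, antipodalRep_compl, dualPUSO]
  have hself : ∀ V : Finset (Fin (m + 1)), V ≠ Vᶜ := fun V h => by
    have := Finset.ext_iff.1 h 0
    simp at this
  refine ⟨fun V i => ?_, ?_, fun I J hIJ hp => hasUniqueSink_of_not_disjoint hsw hIJ hp⟩
  · have he : V ∆ (V ∆ {i}) = {i} := symmDiff_symmDiff_cancel_left V {i}
    have h1 : V ≠ V ∆ {i} := by
      intro h
      rw [← h, symmDiff_self] at he
      exact singleton_ne_empty i he.symm
    have h2 : V ≠ (V ∆ {i})ᶜ := by
      intro h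
      obtain ⟨j, hj⟩ : ∃ j : Fin (m + 1), j ≠ i := by
        have : Nontrivial (Fin (m + 1)) := Fin.nontrivial_iff_two_le.2 (by omega)
        exact exists_ne i
      have := Finset.ext_iff.1 h j
      simp [hj] at this
    have h := hsw _ _ h1 h2
    rwa [he, disjoint_singleton_left, not_not] at h
  · rintro ⟨V, hV, hu⟩
    refine hself V (hu Vᶜ ⟨empty_subset _, subset_univ _, ?_⟩).symm
    rw [hcompl]
    exact hV.2.2

theorem dualPUSO_injective {m : ℕ} {p q : Bool} {ψ χ : Finset (Fin m) → Finset (Fin m)}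
    (hψ : IsOddUSO ψ) (hχ : IsOddUSO χ) (h : dualPUSO p ψ = dualPUSO q χ) : p = q ∧ ψ = χ := by
  have hpq : p = q := by
    have h' := congrFun h ∅
    have e := odd_card_parityLift (p := p) (X := Function.invFun ψ (antipodalRep ∅))
    rw [← dualPUSO, h', dualPUSO, odd_card_parityLift] at e
    exact Bool.eq_iff_iff.2 e.symm
  subst hpq
  refine ⟨rfl, funext fun X => ?_⟩
  have hsurj : Function.Surjective χ := Finite.surjective_of_injective hχ.injective
  -- a vertex of the large cube that represents `ψ X`
  have hrep : antipodalRep ((ψ X).map Fin.castSuccEmb) = ψ X := by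
    ext i
    simp
  have h' := parityLift_injective (congrFun h ((ψ X).map Fin.castSuccEmb))
  rw [hrep, Function.leftInverse_invFun hψ.injective] at h'
  conv_rhs => rw [h', Function.rightInverse_invFun hsurj]

theorem puso_succ_le_card_of_injective {m : ℕ} {ι : Type*} [Finite ι]
    (g : Bool × {ψ : Finset (Fin m) → Finset (Fin m) // IsOddUSO ψ} → ι)
    (hg : Function.Injective g) : puso (m + 1) ≤ Nat.card ι := by
  have hex : ∀ φ : {φ : Finset (Fin (m + 1)) → Finset (Fin (m + 1)) // IsPUSO φ},
      ∃ q : Bool × {ψ : Finset (Fin m) → Finset (Fin m) // IsOddUSO ψ},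
        ∀ V, ∃ X, φ.1 V = parityLift q.1 X ∧ antipodalRep V = q.2.1 X := by
    rintro ⟨φ, hφ⟩
    obtain ⟨p, ψ, hψ, h⟩ := hφ.exists_oddUSO
    exact ⟨⟨p, ψ, hψ⟩, h⟩
  choose q hq using hex
  refine Nat.card_le_card_of_injective (g ∘ q) (hg.comp fun φ φ' h => ?_)
  apply Subtype.ext
  funext V
  obtain ⟨X, h1, h2⟩ := hq φ V
  obtain ⟨X', h1', h2'⟩ := hq φ' V
  rw [← h] at h1' h2'
  rw [h1, h1', (q φ).2.2.injective (h2.symm.trans h2')]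

theorem two_mul_card_le_puso_succ {m : ℕ} (hm : m ≠ 0) :
    2 * Nat.card {ψ : Finset (Fin m) → Finset (Fin m) // IsOddUSO ψ} ≤ puso (m + 1) := by
  have : Nat.card (Bool × {ψ : Finset (Fin m) → Finset (Fin m) // IsOddUSO ψ}) ≤ puso (m + 1) := by
    refine Nat.card_le_card_of_injective
      (fun q => (⟨dualPUSO q.1 q.2.1, q.2.2.isPUSO_dualPUSO hm q.1⟩ :
        {φ : Finset (Fin (m + 1)) → Finset (Fin (m + 1)) // IsPUSO φ})) ?_
    rintro ⟨p, ψ, hψ⟩ ⟨q, χ, hχ⟩ h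
    obtain ⟨rfl, rfl⟩ := dualPUSO_injective hψ hχ (congrArg Subtype.val h)
    rfl
  simpa [Nat.card_prod] using this

/-! ### Potentials of odd unique sink orientations -/

/-- The orientation obtained from the Klee–Minty orientation, in which `i` is outgoing at `X` iff
`X` has an odd number of elements `j ≥ i`, by flipping all edges along which `F` changes. -/
def potentialOutmap {m : ℕ} (F : Finset (Fin m) → Bool) (X : Finset (Fin m)) : Finset (Fin m) :=
  {i | ((decide (Odd #{j ∈ X | i ≤ j}) ^^ F X) ^^ F (X ∆ {i})) = true}

theorem mem_potentialOutmap {m : ℕ} {F : Finset (Fin m) → Bool} {X : Finset (Fin m)} {i : Fin m} :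
    i ∈ potentialOutmap F X ↔ ((decide (Odd #{j ∈ X | i ≤ j}) ^^ F X) ^^ F (X ∆ {i})) = true := by
  simp [potentialOutmap]

theorem odd_card_filter_symmDiff {α : Type*} [DecidableEq α] (P : α → Prop) [DecidablePred P]
    (X Y : Finset α) :
    Odd #{j ∈ X ∆ Y | P j} ↔ ¬ (Odd #{j ∈ X | P j} ↔ Odd #{j ∈ Y | P j}) := by
  rw [← odd_card_symmDiff]
  have : {j ∈ X ∆ Y | P j} = {j ∈ X | P j} ∆ {j ∈ Y | P j} := by
    ext j
    simp only [mem_filter, mem_symmDiff]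
    tauto
  rw [this]

theorem mem_potentialOutmap_symmDiff {m : ℕ} {F : Finset (Fin m) → Bool} {X Y : Finset (Fin m)}
    {i : Fin m} : i ∈ potentialOutmap F X ∆ potentialOutmap F Y ↔
      (decide (Odd #{j ∈ X ∆ Y | i ≤ j}) ^^
        ((F X ^^ F Y) ^^ (F (X ∆ {i}) ^^ F (Y ∆ {i})))) = true := by
  simp only [odd_card_filter_symmDiff, mem_symmDiff, mem_potentialOutmap]
  generalize F X = a, F Y = b, F (X ∆ {i}) = c, F (Y ∆ {i}) = d
  by_cases h1 : Odd #{j ∈ X | i ≤ j} <;> by_cases h2 : Odd #{j ∈ Y | i ≤ j} <;>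
    simp only [h1, h2] <;> revert a b c d <;> decide

/-- A closed `1`-cochain modulo `2` on the cube is exact. -/
theorem exists_potential {α : Type*} [Fintype α] [DecidableEq α] (b : α → Finset α → Bool)
    (hb : ∀ i X, b i (X ∆ {i}) = b i X)
    (hc : ∀ i j X, i ≠ j → (b i X ^^ b i (X ∆ {j})) = (b j X ^^ b j (X ∆ {i}))) (p : Bool) :
    ∃ F : Finset α → Bool, F ∅ = p ∧ ∀ i X, (F X ^^ F (X ∆ {i})) = b i X := by
  suffices h : ∀ T : Finset α, ∃ F : Finset α → Bool,
      F ∅ = p ∧ ∀ i ∈ T, ∀ X, (F X ^^ F (X ∆ {i})) = b i X by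
    obtain ⟨F, h0, hF⟩ := h univ
    exact ⟨F, h0, fun i => hF i (mem_univ i)⟩
  intro T
  induction T using Finset.induction_on with
  | empty => exact ⟨fun _ => p, rfl, by simp⟩
  | insert t T ht ih =>
    obtain ⟨F, h0, hF⟩ := ih
    refine ⟨fun X => F (X.erase t) ^^ (decide (t ∈ X) && b t (X.erase t)), by simpa using h0, ?_⟩
    intro i hi X
    have hbe : ∀ j Y, b j (Y.erase t) = if t ∈ Y then b j (Y ∆ {t}) else b j Y := by
      intro j Y
      split_ifs with h
      · congr 1
        ext k
        by_cases hk : k = t <;> simp [mem_symmDiff, hk, h]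
      · rw [erase_eq_of_notMem h]
    rcases eq_or_ne i t with rfl | hit
    · have he : (X ∆ {i}).erase i = X.erase i := by
        ext k
        by_cases hk : k = i <;> simp [mem_symmDiff, hk]
      have hm : i ∈ X ∆ {i} ↔ i ∉ X := by simp [mem_symmDiff]
      have hbX : b i (X.erase i) = b i X := by rw [hbe, hb, ite_self]
      simp only [he, hm, hbX]
      by_cases h : i ∈ X <;> cases F (X.erase i) <;> simp [h]
    · have hiT : i ∈ T := (mem_insert.1 hi).resolve_left hit
      have he : (X ∆ {i}).erase t = X.erase t ∆ {i} := by
        ext k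
        by_cases hk : k = t
        · subst hk; simp [mem_symmDiff, hit.symm]
        · simp [mem_symmDiff, hk]
      have hm : t ∈ X ∆ {i} ↔ t ∈ X := by simp [mem_symmDiff, hit.symm]
      have h1 := hF i hiT (X.erase t)
      have hbt : ∀ Y, b t (Y.erase t) = b t Y := fun Y => by rw [hbe, hb, ite_self]
      rw [hbe] at h1
      have h2 := hc i t X hit
      rw [← he] at h1
      simp only [hm, hbt]
      by_cases h : t ∈ X
      · simp only [h, if_true, decide_true, Bool.true_and] at h1 ⊢
        revert h1 h2
        generalize F (X.erase t) = a, F ((X ∆ {i}).erase t) = c, b i (X ∆ {t}) = d, b i X = e,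
          b t X = f, b t (X ∆ {i}) = g
        revert a c d e f g
        decide
      · simpa [h] using h1

/-- On every `2`-face an odd unique sink orientation has one pair of parallel and one pair of
antiparallel edges, like the Klee–Minty orientation. Hence the set of edges on which the two differ
is a closed cochain and has a potential. -/
theorem IsOddUSO.exists_potentialOutmap_eq {m : ℕ} {ψ : Finset (Fin m) → Finset (Fin m)}
    (hψ : IsOddUSO ψ) (p : Bool) :
    ∃ F : Finset (Fin m) → Bool, F ∅ = p ∧ potentialOutmap F = ψ := by
  have hedge : ∀ i X, i ∈ ψ (X ∆ {i}) ↔ i ∉ ψ X := by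
    intro i X
    have he : X ∆ (X ∆ {i}) = {i} := symmDiff_symmDiff_cancel_left X {i}
    have hne : X ≠ X ∆ {i} := by
      intro h
      rw [← h, symmDiff_self] at he
      exact singleton_ne_empty i he.symm
    have := (hψ _ _ hne).1
    rw [he, disjoint_singleton_left, not_not, mem_symmDiff] at this
    tauto
  have hparity : ∀ (i j : Fin m) (X : Finset (Fin m)),
      Odd #{k ∈ X ∆ {j} | i ≤ k} ↔ ¬ (Odd #{k ∈ X | i ≤ k} ↔ i ≤ j) := by
    intro i j X
    rw [odd_card_filter_symmDiff, filter_singleton]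
    split_ifs with h <;> simp [h]
  have hdouble : ∀ i j X, i < j →
      (((decide (i ∈ ψ X) ^^ decide (i ∈ ψ (X ∆ {j}))) ^^
        (decide (j ∈ ψ X) ^^ decide (j ∈ ψ (X ∆ {i}))))) = true := by
    intro i j X hij
    have he : X ∆ ((X ∆ {j}) ∆ {i}) = {i, j} := by
      rw [symmDiff_assoc, symmDiff_symmDiff_cancel_left]
      ext k
      simp only [mem_symmDiff, mem_singleton, mem_insert]
      have := hij.ne
      grind
    have hne : X ≠ (X ∆ {j}) ∆ {i} := by
      intro h
      rw [← h, symmDiff_self] at he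
      exact insert_ne_empty i {j} he.symm
    have h := hψ _ _ hne
    have hcard : #({i, j} : Finset (Fin m)) = 2 := card_pair hij.ne
    have e1 := hedge i (X ∆ {j})
    have e2 := hedge j (X ∆ {i})
    rw [symmDiff_right_comm] at e2
    rw [he, hcard] at h
    have h2 : ¬ Odd 2 := by decide
    simp only [h2, disjoint_insert_left, disjoint_singleton_left, insert_subset_iff,
      singleton_subset_iff, imp_false, mem_symmDiff, e1, e2] at h
    by_cases c1 : i ∈ ψ X <;> by_cases c2 : i ∈ ψ (X ∆ {j}) <;>
      by_cases c3 : j ∈ ψ X <;> by_cases c4 : j ∈ ψ (X ∆ {i}) <;>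
      simp [c1, c2, c3, c4] at h ⊢
  obtain ⟨F, h0, hF⟩ := exists_potential
    (fun i X => decide (i ∈ ψ X) ^^ decide (Odd #{j ∈ X | i ≤ j})) (fun i X => by
      simp only [hedge, hparity, le_refl, iff_true]
      by_cases c1 : i ∈ ψ X <;> by_cases c2 : Odd #{j ∈ X | i ≤ j} <;> simp [c1, c2]) (by
      have hlt : ∀ i j X, i < j →
          ((decide (i ∈ ψ X) ^^ decide (Odd #{k ∈ X | i ≤ k})) ^^
            (decide (i ∈ ψ (X ∆ {j})) ^^ decide (Odd #{k ∈ X ∆ {j} | i ≤ k}))) =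
          ((decide (j ∈ ψ X) ^^ decide (Odd #{k ∈ X | j ≤ k})) ^^
            (decide (j ∈ ψ (X ∆ {i})) ^^ decide (Odd #{k ∈ X ∆ {i} | j ≤ k}))) := by
        intro i j X hij
        have h := hdouble i j X hij
        simp only [hparity, hij.le, hij.not_ge, iff_true, iff_false, not_not, decide_not]
        revert h
        generalize decide (i ∈ ψ X) = a, decide (i ∈ ψ (X ∆ {j})) = b, decide (j ∈ ψ X) = c,
          decide (j ∈ ψ (X ∆ {i})) = d, decide (Odd #{k ∈ X | i ≤ k}) = e,
          decide (Odd #{k ∈ X | j ≤ k}) = f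
        revert a b c d e f
        decide
      intro i j X hij
      rcases lt_or_gt_of_ne hij with h | h
      · exact hlt i j X h
      · exact (hlt j i X h).symm) p
  refine ⟨F, h0, funext fun X => ?_⟩
  ext i
  rw [mem_potentialOutmap, Bool.xor_assoc, hF]
  by_cases c1 : i ∈ ψ X <;> by_cases c2 : Odd #{j ∈ X | i ≤ j} <;> simp [c1, c2]

theorem puso_succ_le_card_potential (m : ℕ) :
    puso (m + 1) ≤ Nat.card {F : Finset (Fin m) → Bool // IsOddUSO (potentialOutmap F)} := by
  have hex : ∀ q : Bool × {ψ : Finset (Fin m) → Finset (Fin m) // IsOddUSO ψ},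
      ∃ F : {F : Finset (Fin m) → Bool // IsOddUSO (potentialOutmap F)},
        F.1 ∅ = q.1 ∧ potentialOutmap F.1 = q.2.1 := by
    rintro ⟨p, ψ, hψ⟩
    obtain ⟨F, h0, hF⟩ := hψ.exists_potentialOutmap_eq p
    exact ⟨⟨F, hF ▸ hψ⟩, h0, hF⟩
  choose g h0 hg using hex
  refine puso_succ_le_card_of_injective g fun q r h => ?_
  refine Prod.ext ?_ (Subtype.ext ?_)
  · rw [← h0 q, h, h0]
  · rw [← hg q, h, hg]

theorem puso_le_two_pow {n : ℕ} (hn : n ≠ 0) : puso n ≤ 2 ^ 2 ^ (n - 1) := by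
  obtain ⟨m, rfl⟩ := Nat.exists_eq_succ_of_ne_zero hn
  refine (puso_succ_le_card_potential m).trans ?_
  refine (Nat.card_le_card_of_injective _ Subtype.val_injective).trans ?_
  simp [Nat.card_eq_fintype_card]

/-! ### Counting with bit sets -/

/-- The truth table of the `j`-th of `N` Boolean variables: bit `a` of this number, for `a < 2 ^ N`,
is bit `j` of `a`. -/
def truthTable : ℕ → ℕ → ℕ
  | 0, _ => 0
  | N + 1, j => if j = N then (2 ^ 2 ^ N - 1) <<< 2 ^ N
      else truthTable N j + truthTable N j <<< 2 ^ N

theorem truthTable_lt (N j : ℕ) : truthTable N j < 2 ^ 2 ^ N := by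
  induction N with
  | zero => simp [truthTable]
  | succ N ih =>
    have h2 : (2 : ℕ) ^ 2 ^ (N + 1) = 2 ^ 2 ^ N * 2 ^ 2 ^ N := by rw [← pow_add]; congr 1; ring
    rw [truthTable, h2]
    split_ifs
    · rw [Nat.shiftLeft_eq]
      exact Nat.mul_lt_mul_of_pos_right (Nat.sub_lt (by positivity) one_pos) (by positivity)
    · rw [Nat.shiftLeft_eq]
      nlinarith

theorem testBit_truthTable {N j a : ℕ} (hj : j < N) (ha : a < 2 ^ N) :
    (truthTable N j).testBit a = a.testBit j := by
  induction N generalizing a with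
  | zero => omega
  | succ N ih =>
    rw [truthTable]
    split_ifs with h
    · subst h
      rw [Nat.testBit_shiftLeft, Nat.testBit_two_pow_sub_one]
      by_cases hlt : a < 2 ^ j
      · rw [Nat.testBit_lt_two_pow hlt]
        simp [hlt]
      · have h1 : a - 2 ^ j < 2 ^ j := by omega
        have h2 : a.testBit j = true := by
          obtain ⟨c, rfl⟩ := Nat.exists_eq_add_of_le (not_lt.1 hlt)
          rw [Nat.testBit_two_pow_add_eq, Nat.testBit_lt_two_pow (by omega)]
          rfl
        rw [h2]
        simp [h1, not_lt.1 hlt]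
    · have hjN : j < N := by omega
      rw [add_comm, Nat.shiftLeft_eq, mul_comm, Nat.testBit_two_pow_mul_add _ (truthTable_lt N j)]
      split_ifs with hlt
      · exact ih hjN hlt
      · rw [ih hjN (by omega)]
        obtain ⟨c, rfl⟩ := Nat.exists_eq_add_of_le (not_lt.1 hlt)
        rw [Nat.add_sub_cancel_left, Nat.testBit_two_pow_add_gt hjN]

/-- The sum of the numbers formed by the bits of `w` at the positions `≡ s` modulo the digit length,
over all `s < r`; the set bits of `M` are the multiples of the digit length. -/
def sumSlices (M w : ℕ) : ℕ → ℕ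
  | 0 => 0
  | r + 1 => sumSlices M w r + (w >>> r &&& M)

/-- The number of bits of `w` below position `B * Q`, computed by casting out `2 ^ B - 1`. -/
def popCount (B Q w : ℕ) : ℕ :=
  sumSlices ((2 ^ (B * Q) - 1) / (2 ^ B - 1)) w B % (2 ^ B - 1)

theorem sum_range_mul {M : Type*} [AddCommMonoid M] (B Q : ℕ) (u : ℕ → M) :
    ∑ a ∈ range (B * Q), u a = ∑ q ∈ range Q, ∑ s ∈ range B, u (B * q + s) := by
  induction Q with
  | zero => simp
  | succ Q ih => rw [Nat.mul_succ, sum_range_add, ih, sum_range_succ]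

theorem and_sum_modEq {B : ℕ} (hB : 0 < B) (Q w : ℕ) :
    (w &&& ∑ q ∈ range Q, (2 ^ B) ^ q) ≡ ∑ q ∈ range Q, (w.testBit (B * q)).toNat
      [MOD 2 ^ B - 1] := by
  induction Q with
  | zero => rw [sum_range_zero, Nat.and_zero]; rfl
  | succ Q ih =>
    have h2 : 2 ≤ 2 ^ B := (Nat.pow_le_pow_right (by norm_num) hB).trans' (by norm_num)
    have hlt : ∑ q ∈ range Q, (2 ^ B) ^ q < 2 ^ (B * Q) := by
      rw [pow_mul]
      exact Nat.geomSum_lt h2 (by simp)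
    have hone : 2 ^ (B * Q) ≡ 1 [MOD 2 ^ B - 1] := by
      have : 2 ^ B ≡ 1 [MOD 2 ^ B - 1] := by
        conv_lhs => rw [← Nat.sub_add_cancel (show 1 ≤ 2 ^ B by omega)]
        simp [Nat.ModEq]
      rw [pow_mul]
      simpa using this.pow Q
    have hor : w &&& ((∑ q ∈ range Q, (2 ^ B) ^ q) + 2 ^ (B * Q)) =
        2 ^ (B * Q) * (w.testBit (B * Q)).toNat + (w &&& ∑ q ∈ range Q, (2 ^ B) ^ q) := by
      have h1 := Nat.two_pow_add_eq_or_of_lt hlt 1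
      rw [mul_one] at h1
      rw [Nat.two_pow_add_eq_or_of_lt (Nat.and_le_right.trans_lt hlt), add_comm, h1,
        Nat.and_or_distrib_left, Nat.and_two_pow, mul_comm]
    rw [sum_range_succ, sum_range_succ, ← pow_mul, hor, add_comm]
    refine ih.add ?_
    simpa using hone.mul_right _

theorem sumSlices_modEq {B : ℕ} (hB : 0 < B) (Q w r : ℕ) :
    sumSlices (∑ q ∈ range Q, (2 ^ B) ^ q) w r ≡
      ∑ s ∈ range r, ∑ q ∈ range Q, (w.testBit (B * q + s)).toNat [MOD 2 ^ B - 1] := by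
  induction r with
  | zero => rfl
  | succ r ih =>
    rw [sumSlices, sum_range_succ]
    refine ih.add ?_
    have := and_sum_modEq hB Q (w >>> r)
    simpa only [Nat.testBit_shiftRight, add_comm r] using this

theorem popCount_eq {B Q : ℕ} (hB : 2 ≤ B) (hQ : B * Q < 2 ^ B - 1) (w : ℕ) :
    popCount B Q w = #{a ∈ range (B * Q) | w.testBit a = true} := by
  have hcard : #{a ∈ range (B * Q) | w.testBit a = true} =
      ∑ a ∈ range (B * Q), (w.testBit a).toNat := by
    rw [card_filter]
    refine sum_congr rfl fun a _ => ?_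
    cases w.testBit a <;> rfl
  have h2 : 2 ≤ 2 ^ B := (Nat.pow_le_pow_right (by norm_num) hB).trans' (by norm_num)
  rw [popCount, pow_mul, ← Nat.geomSum_eq h2, sumSlices_modEq (by omega) Q w B, sum_comm,
    ← sum_range_mul B Q fun a => (w.testBit a).toNat, ← hcard]
  exact Nat.mod_eq_of_lt (((card_filter_le _ _).trans_eq (card_range _)).trans_lt hQ)

/-! ### Three-dimensional faces of the five-dimensional cube -/

/-- The condition on the values of a potential at the vertices `∅`, `i`, `j`, `k`, `ij`, `ik`, `jk`,
`ijk` of a `3`-face with coordinates `i < j < k` saying that antipodal vertices of the face have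
different outmaps in the face. -/
def faceOK (a ai aj ak aij aik ajk aijk : Bool) : Bool :=
  ((a ^^ aijk) ^^ (aj ^^ aik)) ||
    (((ai ^^ ajk) ^^ (ak ^^ aij)) || !((a ^^ aijk) ^^ (ai ^^ ajk)))

/-- Every `3`-face of the cube with coordinates `0, …, d - 1` satisfies `faceOK`. -/
def AllFacesOK (d : ℕ) (f : Finset ℕ → Bool) : Prop :=
  ∀ i j k Y, i < j → j < k → k < d → Y ⊆ range d → i ∉ Y → j ∉ Y → k ∉ Y →
    faceOK (f Y) (f (insert i Y)) (f (insert j Y)) (f (insert k Y)) (f (insert i (insert j Y)))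
      (f (insert i (insert k Y))) (f (insert j (insert k Y)))
      (f (insert i (insert j (insert k Y)))) = true

theorem faceOK_affine (a ai aj ak aij aik ajk aijk c ei ej ek : Bool) :
    faceOK (a ^^ c) (ai ^^ (c ^^ ei)) (aj ^^ (c ^^ ej)) (ak ^^ (c ^^ ek)) (aij ^^ ((c ^^ ej) ^^ ei))
      (aik ^^ ((c ^^ ek) ^^ ei)) (ajk ^^ ((c ^^ ek) ^^ ej)) (aijk ^^ (((c ^^ ek) ^^ ej) ^^ ei)) =
    faceOK a ai aj ak aij aik ajk aijk := by
  cases c <;> cases ei <;> cases ej <;> cases ek <;> simp [faceOK]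

/-- The affine function that agrees with `f` at the empty set and at the singletons. -/
def affinePart (f : Finset ℕ → Bool) (Y : Finset ℕ) : Bool :=
  f ∅ ^^ decide (Odd #{i ∈ Y | f {i} ≠ f ∅})

theorem affinePart_insert (f : Finset ℕ → Bool) {i : ℕ} {Y : Finset ℕ} (hi : i ∉ Y) :
    affinePart f (insert i Y) = (affinePart f Y ^^ (f {i} ^^ f ∅)) := by
  have hi' : i ∉ ({i ∈ Y | f {i} ≠ f ∅} : Finset ℕ) := fun h => hi (mem_filter.1 h).1
  unfold affinePart
  rw [filter_insert]
  split_ifs with h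
  · rw [card_insert_of_notMem hi']
    simp only [Nat.odd_add_one]
    have : (f {i} ^^ f ∅) = true := by simpa using h
    rw [this, decide_not, Bool.xor_true, Bool.xor_not]
  · rw [not_not] at h
    simp [h]

theorem affinePart_congr {f g : Finset ℕ → Bool} {Y : Finset ℕ} (h0 : f ∅ = g ∅)
    (h1 : ∀ i ∈ Y, f {i} = g {i}) : affinePart f Y = affinePart g Y := by
  have : ({i ∈ Y | f {i} ≠ f ∅} : Finset ℕ) = {i ∈ Y | g {i} ≠ g ∅} :=
    filter_congr fun i hi => by rw [h0, h1 i hi]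
  rw [affinePart, affinePart, this, h0]

/-- The function `f` with its affine part removed. -/
def removeAffine (f : Finset ℕ → Bool) (Y : Finset ℕ) : Bool := f Y ^^ affinePart f Y

theorem removeAffine_empty (f : Finset ℕ → Bool) : removeAffine f ∅ = false := by
  simp [removeAffine, affinePart]

theorem removeAffine_singleton (f : Finset ℕ → Bool) (i : ℕ) : removeAffine f {i} = false := by
  have h := affinePart_insert f (notMem_empty i)
  have h0 : affinePart f ∅ = f ∅ := by simp [affinePart]
  rw [insert_empty_eq, h0] at h
  rw [removeAffine, h]
  cases f {i} <;> cases f ∅ <;> rfl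

theorem AllFacesOK.allFacesOK_removeAffine {d : ℕ} {f : Finset ℕ → Bool} (hf : AllFacesOK d f) :
    AllFacesOK d (removeAffine f) := by
  intro i j k Y hij hjk hk hY hi hj hk'
  have h1 : j ∉ insert k Y := by simp [hj, hjk.ne]
  have h2 : i ∉ insert j Y := by simp [hi, hij.ne]
  have h3 : i ∉ insert k Y := by simp [hi, (hij.trans hjk).ne]
  have h4 : i ∉ insert j (insert k Y) := by simp [hi, hij.ne, (hij.trans hjk).ne]
  have h := hf i j k Y hij hjk hk hY hi hj hk'
  unfold removeAffine
  rw [affinePart_insert f hi, affinePart_insert f h2, affinePart_insert f h3,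
    affinePart_insert f h4, affinePart_insert f hj, affinePart_insert f h1,
    affinePart_insert f hk', faceOK_affine]
  exact h

/-- A complete binary tree whose leaves are bit sets, one for each vertex of a cube. The right
subtree of a node at height `k + 1` holds the vertices that contain the coordinate `k`. -/
inductive WordTree
  | leaf (w : ℕ)
  | node (l r : WordTree)

namespace WordTree

/-- The tree `t` of height `k` represents, at bit `a`, the Boolean function `g` on the cube with
coordinates `0, …, k - 1`. -/
def Represents (a : ℕ) : ℕ → WordTree → (Finset ℕ → Bool) → Prop
  | 0, leaf w, g => w.testBit a = g ∅
  | k + 1, node l r, g => Represents a k l g ∧ Represents a k r fun Y => g (insert k Y)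
  | _, _, _ => False

theorem Represents.eq {a k : ℕ} {t : WordTree} {g g' : Finset ℕ → Bool} (h : Represents a k t g)
    (h' : Represents a k t g') {Y : Finset ℕ} (hY : Y ⊆ range k) : g Y = g' Y := by
  induction k generalizing t g g' Y with
  | zero =>
    cases t with
    | leaf w =>
      obtain rfl : Y = ∅ := by simpa using hY
      exact Eq.trans (Eq.symm h) h'
    | node l r => exact absurd h id
  | succ k ih =>
    cases t with
    | leaf w => exact absurd h id
    | node l r =>
      by_cases hk : k ∈ Y
      · have := ih h.2 h'.2 (Y := Y.erase k) fun i hi => by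
          have h1 := mem_range.1 (hY (mem_of_mem_erase hi))
          have h2 := ne_of_mem_erase hi
          exact mem_range.2 (by omega)
        simpa only [insert_erase hk] using this
      · refine ih h.1 h'.1 fun i hi => ?_
        have h1 := mem_range.1 (hY hi)
        have h2 : i ≠ k := fun h => hk (h ▸ hi)
        exact mem_range.2 (by omega)

/-- The set of bits at which a `3`-face with the given vertex values satisfies `faceOK`. -/
def faceWord (ones a ai aj ak aij aik ajk aijk : ℕ) : ℕ :=
  ((a ^^^ aijk) ^^^ (aj ^^^ aik)) |||
    (((ai ^^^ ajk) ^^^ (ak ^^^ aij)) ||| (((a ^^^ aijk) ^^^ (ai ^^^ ajk)) ^^^ ones))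

/-- The bits at which `faceOK` holds for all `3`-faces with one vertex in each of eight parallel
subcubes. -/
def word₃ (ones : ℕ) :
    WordTree → WordTree → WordTree → WordTree → WordTree → WordTree → WordTree → WordTree → ℕ
  | node a a', node b b', node c c', node d d', node e e', node f f', node g g', node h h' =>
    word₃ ones a b c d e f g h &&& word₃ ones a' b' c' d' e' f' g' h'
  | leaf a, leaf b, leaf c, leaf d, leaf e, leaf f, leaf g, leaf h =>
    faceWord ones a b c d e f g h
  | _, _, _, _, _, _, _, _ => ones

/-- The bits at which `faceOK` holds for all `3`-faces with one edge in each of four parallel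
subcubes. -/
def word₂ (ones : ℕ) : WordTree → WordTree → WordTree → WordTree → ℕ
  | node a a', node b b', node c c', node d d' =>
    word₃ ones a a' b c b' c' d d' &&& (word₂ ones a b c d &&& word₂ ones a' b' c' d')
  | _, _, _, _ => ones

/-- The bits at which `faceOK` holds for all `3`-faces with one `2`-face in each of two parallel
subcubes. -/
def word₁ (ones : ℕ) : WordTree → WordTree → ℕ
  | node a a', node b b' =>
    word₂ ones a a' b b' &&& (word₁ ones a b &&& word₁ ones a' b')
  | _, _ => ones

/-- The bits at which `faceOK` holds for all `3`-faces of a cube. -/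
def word₀ (ones : ℕ) : WordTree → ℕ
  | node a a' => word₁ ones a a' &&& (word₀ ones a &&& word₀ ones a')
  | leaf _ => ones

variable {ones x : ℕ}

theorem testBit_faceWord (hx : ones.testBit x = true) (a ai aj ak aij aik ajk aijk : ℕ) :
    (faceWord ones a ai aj ak aij aik ajk aijk).testBit x =
      faceOK (a.testBit x) (ai.testBit x) (aj.testBit x) (ak.testBit x) (aij.testBit x)
        (aik.testBit x) (ajk.testBit x) (aijk.testBit x) := by
  simp only [faceWord, faceOK, Nat.testBit_or, Nat.testBit_xor, hx, Bool.xor_true]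

theorem insert_subset_range {k : ℕ} {Y : Finset ℕ} (hY : Y ⊆ range k) :
    insert k Y ⊆ range (k + 1) := by
  rw [range_add_one]
  exact insert_subset_insert k hY

theorem subset_range_succ {k : ℕ} {Y : Finset ℕ} (hY : Y ⊆ range k) : Y ⊆ range (k + 1) :=
  hY.trans (range_subset_range.2 k.le_succ)

theorem notMem_of_subset_range {k : ℕ} {Y : Finset ℕ} (hY : Y ⊆ range k) : k ∉ Y :=
  fun h => lt_irrefl k (mem_range.1 (hY h))

theorem testBit_word₃ (hx : ones.testBit x = true) {k : ℕ} {a b c d e f g h : WordTree}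
    {ga gb gc gd ge gf gg gh : Finset ℕ → Bool} (ha : Represents x k a ga)
    (hb : Represents x k b gb) (hc : Represents x k c gc) (hd : Represents x k d gd)
    (he : Represents x k e ge) (hf : Represents x k f gf) (hg : Represents x k g gg)
    (hh : Represents x k h gh)
    (hok : ∀ Y ⊆ range k, faceOK (ga Y) (gb Y) (gc Y) (gd Y) (ge Y) (gf Y) (gg Y) (gh Y) = true) :
    (word₃ ones a b c d e f g h).testBit x = true := by
  induction k generalizing a b c d e f g h ga gb gc gd ge gf gg gh with
  | zero =>
    rcases a with a | _ <;> [skip; exact absurd ha id]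
    rcases b with b | _ <;> [skip; exact absurd hb id]
    rcases c with c | _ <;> [skip; exact absurd hc id]
    rcases d with d | _ <;> [skip; exact absurd hd id]
    rcases e with e | _ <;> [skip; exact absurd he id]
    rcases f with f | _ <;> [skip; exact absurd hf id]
    rcases g with g | _ <;> [skip; exact absurd hg id]
    rcases h with h | _ <;> [skip; exact absurd hh id]
    simp only [Represents] at ha hb hc hd he hf hg hh
    rw [word₃, testBit_faceWord hx, ha, hb, hc, hd, he, hf, hg, hh]
    exact hok ∅ (empty_subset _)
  | succ k ih =>
    rcases a with _ | ⟨a, a'⟩ <;> [exact absurd ha id; skip]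
    rcases b with _ | ⟨b, b'⟩ <;> [exact absurd hb id; skip]
    rcases c with _ | ⟨c, c'⟩ <;> [exact absurd hc id; skip]
    rcases d with _ | ⟨d, d'⟩ <;> [exact absurd hd id; skip]
    rcases e with _ | ⟨e, e'⟩ <;> [exact absurd he id; skip]
    rcases f with _ | ⟨f, f'⟩ <;> [exact absurd hf id; skip]
    rcases g with _ | ⟨g, g'⟩ <;> [exact absurd hg id; skip]
    rcases h with _ | ⟨h, h'⟩ <;> [exact absurd hh id; skip]
    rw [word₃, Nat.testBit_and, Bool.and_eq_true]
    exact ⟨ih ha.1 hb.1 hc.1 hd.1 he.1 hf.1 hg.1 hh.1 fun Y hY => hok Y (subset_range_succ hY),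
      ih ha.2 hb.2 hc.2 hd.2 he.2 hf.2 hg.2 hh.2 fun Y hY => hok _ (insert_subset_range hY)⟩

theorem testBit_word₂ (hx : ones.testBit x = true) {k : ℕ} {a b c d : WordTree}
    {ga gb gc gd : Finset ℕ → Bool} (ha : Represents x k a ga)
    (hb : Represents x k b gb) (hc : Represents x k c gc) (hd : Represents x k d gd)
    (hok : ∀ i Y, i < k → Y ⊆ range k → i ∉ Y →
      faceOK (ga Y) (ga (insert i Y)) (gb Y) (gc Y) (gb (insert i Y)) (gc (insert i Y)) (gd Y)
        (gd (insert i Y)) = true) :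
    (word₂ ones a b c d).testBit x = true := by
  induction k generalizing a b c d ga gb gc gd with
  | zero =>
    rcases a with a | _ <;> [skip; exact absurd ha id]
    simpa [word₂] using hx
  | succ k ih =>
    rcases a with _ | ⟨a, a'⟩ <;> [exact absurd ha id; skip]
    rcases b with _ | ⟨b, b'⟩ <;> [exact absurd hb id; skip]
    rcases c with _ | ⟨c, c'⟩ <;> [exact absurd hc id; skip]
    rcases d with _ | ⟨d, d'⟩ <;> [exact absurd hd id; skip]
    rw [word₂, Nat.testBit_and, Nat.testBit_and, Bool.and_eq_true, Bool.and_eq_true]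
    refine ⟨testBit_word₃ hx ha.1 ha.2 hb.1 hc.1 hb.2 hc.2 hd.1 hd.2 fun Y hY =>
      hok k Y k.lt_succ_self (subset_range_succ hY) (notMem_of_subset_range hY),
      ih ha.1 hb.1 hc.1 hd.1 fun i Y hi hY hiY =>
        hok i Y (hi.trans k.lt_succ_self) (subset_range_succ hY) hiY,
      ih ha.2 hb.2 hc.2 hd.2 fun i Y hi hY hiY => ?_⟩
    have := hok i (insert k Y) (hi.trans k.lt_succ_self) (insert_subset_range hY)
      (by simp [hi.ne, hiY])
    simpa only [insert_comm i k] using this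

theorem testBit_word₁ (hx : ones.testBit x = true) {k : ℕ} {a b : WordTree}
    {ga gb : Finset ℕ → Bool} (ha : Represents x k a ga) (hb : Represents x k b gb)
    (hok : ∀ i j Y, i < j → j < k → Y ⊆ range k → i ∉ Y → j ∉ Y →
      faceOK (ga Y) (ga (insert i Y)) (ga (insert j Y)) (gb Y) (ga (insert i (insert j Y)))
        (gb (insert i Y)) (gb (insert j Y)) (gb (insert i (insert j Y))) = true) :
    (word₁ ones a b).testBit x = true := by
  induction k generalizing a b ga gb with
  | zero =>
    rcases a with a | _ <;> [skip; exact absurd ha id]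
    simpa [word₁] using hx
  | succ k ih =>
    rcases a with _ | ⟨a, a'⟩ <;> [exact absurd ha id; skip]
    rcases b with _ | ⟨b, b'⟩ <;> [exact absurd hb id; skip]
    rw [word₁, Nat.testBit_and, Nat.testBit_and, Bool.and_eq_true, Bool.and_eq_true]
    refine ⟨testBit_word₂ hx ha.1 ha.2 hb.1 hb.2 fun i Y hi hY hiY => ?_,
      ih ha.1 hb.1 fun i j Y hij hj hY hiY hjY =>
        hok i j Y hij (hj.trans k.lt_succ_self) (subset_range_succ hY) hiY hjY,
      ih ha.2 hb.2 fun i j Y hij hj hY hiY hjY => ?_⟩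
    · have := hok i k Y hi k.lt_succ_self (subset_range_succ hY) hiY (notMem_of_subset_range hY)
      simpa only [insert_comm i k] using this
    · have := hok i j (insert k Y) hij (hj.trans k.lt_succ_self) (insert_subset_range hY)
        (by simp [(hij.trans hj).ne, hiY]) (by simp [hj.ne, hjY])
      simpa only [insert_comm i k, insert_comm j k] using this

theorem testBit_word₀ (hx : ones.testBit x = true) {k : ℕ} {a : WordTree} {ga : Finset ℕ → Bool}
    (ha : Represents x k a ga) (hok : AllFacesOK k ga) : (word₀ ones a).testBit x = true := by
  induction k generalizing a ga with
  | zero =>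
    rcases a with a | _ <;> [skip; exact absurd ha id]
    simpa [word₀] using hx
  | succ k ih =>
    rcases a with _ | ⟨a, a'⟩ <;> [exact absurd ha id; skip]
    rw [word₀, Nat.testBit_and, Nat.testBit_and, Bool.and_eq_true, Bool.and_eq_true]
    refine ⟨testBit_word₁ hx ha.1 ha.2 fun i j Y hij hj hY hiY hjY => ?_,
      ih ha.1 fun i j l Y hij hjl hl hY hiY hjY hlY =>
        hok i j l Y hij hjl (hl.trans k.lt_succ_self) (subset_range_succ hY) hiY hjY hlY,
      ih ha.2 fun i j l Y hij hjl hl hY hiY hjY hlY => ?_⟩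
    · have := hok i j k Y hij hj k.lt_succ_self (subset_range_succ hY) hiY hjY
        (notMem_of_subset_range hY)
      simpa only [insert_comm i k, insert_comm j k] using this
    · have := hok i j l (insert k Y) hij hjl (hl.trans k.lt_succ_self) (insert_subset_range hY)
        (by simp [(hij.trans (hjl.trans hl)).ne, hiY]) (by simp [(hjl.trans hl).ne, hjY])
        (by simp [hl.ne, hlY])
      simpa only [insert_comm i k, insert_comm j k, insert_comm l k] using this

end WordTree

/-! ### The number of potentials on the five-dimensional cube -/

namespace WordTree

/-- A Boolean constant as a leaf with `2 ^ 20` bits. -/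
def const (b : Bool) : WordTree := leaf (bif b then 2 ^ 2 ^ 20 - 1 else 0)

/-- The `j`-th of `20` Boolean variables as a leaf. -/
def var (j : ℕ) : WordTree := leaf (truthTable 20 j)

/-- The functions on the `5`-cube that vanish at the empty set and at the singletons. The `26`
remaining values are independent: the first six are the bits of `p`, and the last `20` are given by
the position in the bit sets. -/
def normalized (p : ℕ) : WordTree :=
  let z := const false
  let c := fun j => const (p.testBit j)
  let v := var
  node
    (node
      (node
        (node (node z z) (node z (c 0)))
        (node (node z (c 1)) (node (c 2) (c 3))))
      (node
        (node (node z (c 4)) (node (c 5) (v 0)))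
        (node (node (v 1) (v 2)) (node (v 3) (v 4)))))
    (node
      (node
        (node (node z (v 5)) (node (v 6) (v 7)))
        (node (node (v 8) (v 9)) (node (v 10) (v 11))))
      (node
        (node (node (v 12) (v 13)) (node (v 14) (v 15)))
        (node (node (v 16) (v 17)) (node (v 18) (v 19)))))

/-- The set of the functions `normalized p` that satisfy `faceOK` on all `3`-faces. -/
def solutions (p : ℕ) : ℕ := word₀ (2 ^ 2 ^ 20 - 1) (normalized p)

theorem exists_represents_normalized (f : Finset ℕ → Bool) (h0 : f ∅ = false)
    (h1 : ∀ i, f {i} = false) :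
    ∃ p < 64, ∃ x < 2 ^ 20, Represents x 5 (normalized p) f := by
  let u : Fin 6 → Bool := ![f {1, 0}, f {2, 0}, f {2, 1}, f {2, 1, 0}, f {3, 0}, f {3, 1}]
  let w : Fin 20 → Bool := ![f {3, 1, 0}, f {3, 2}, f {3, 2, 0}, f {3, 2, 1}, f {3, 2, 1, 0},
    f {4, 0}, f {4, 1}, f {4, 1, 0}, f {4, 2}, f {4, 2, 0}, f {4, 2, 1}, f {4, 2, 1, 0}, f {4, 3},
    f {4, 3, 0}, f {4, 3, 1}, f {4, 3, 1, 0}, f {4, 3, 2}, f {4, 3, 2, 0}, f {4, 3, 2, 1},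
    f {4, 3, 2, 1, 0}]
  have hx : Nat.ofBits w < 2 ^ 20 := Nat.ofBits_lt_two_pow w
  refine ⟨Nat.ofBits u, Nat.ofBits_lt_two_pow u, Nat.ofBits w, hx, ?_⟩
  have hc : ∀ (b : Bool) (g : Finset ℕ → Bool), b = g ∅ →
      Represents (Nat.ofBits w) 0 (const b) g := by
    rintro b g h
    rw [const, Represents, ← h]
    cases b
    · exact Nat.zero_testBit _
    · rw [cond_true, Nat.testBit_two_pow_sub_one]
      simpa using hx
  have hu : ∀ (j : ℕ) (hj : j < 6) (g : Finset ℕ → Bool), u ⟨j, hj⟩ = g ∅ →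
      Represents (Nat.ofBits w) 0 (const ((Nat.ofBits u).testBit j)) g := by
    intro j hj g h
    exact hc _ _ (by rw [Nat.testBit_ofBits_lt u j hj, h])
  have hv : ∀ (j : ℕ) (hj : j < 20) (g : Finset ℕ → Bool), w ⟨j, hj⟩ = g ∅ →
      Represents (Nat.ofBits w) 0 (var j) g := by
    intro j hj g h
    rw [var, Represents, testBit_truthTable hj hx, Nat.testBit_ofBits_lt w j hj, h]
  have hz : ∀ g : Finset ℕ → Bool, g ∅ = false →
      Represents (Nat.ofBits w) 0 (const false) g := fun g h => hc _ _ h.symm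
  exact ⟨⟨⟨⟨⟨hz _ h0, hz _ (h1 0)⟩, hz _ (h1 1), hu 0 (by decide) _ rfl⟩,
      ⟨hz _ (h1 2), hu 1 (by decide) _ rfl⟩, hu 2 (by decide) _ rfl, hu 3 (by decide) _ rfl⟩,
      ⟨⟨hz _ (h1 3), hu 4 (by decide) _ rfl⟩, hu 5 (by decide) _ rfl, hv 0 (by decide) _ rfl⟩,
      ⟨hv 1 (by decide) _ rfl, hv 2 (by decide) _ rfl⟩, hv 3 (by decide) _ rfl,
      hv 4 (by decide) _ rfl⟩,
    ⟨⟨⟨hz _ (h1 4), hv 5 (by decide) _ rfl⟩, hv 6 (by decide) _ rfl, hv 7 (by decide) _ rfl⟩,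
      ⟨hv 8 (by decide) _ rfl, hv 9 (by decide) _ rfl⟩, hv 10 (by decide) _ rfl,
      hv 11 (by decide) _ rfl⟩,
    ⟨⟨hv 12 (by decide) _ rfl, hv 13 (by decide) _ rfl⟩, hv 14 (by decide) _ rfl,
      hv 15 (by decide) _ rfl⟩,
    ⟨hv 16 (by decide) _ rfl, hv 17 (by decide) _ rfl⟩, hv 18 (by decide) _ rfl,
      hv 19 (by decide) _ rfl⟩

/-- The number of functions `normalized p` with `8 * q ≤ p < 8 * (q + 1)` that satisfy `faceOK` on
all `3`-faces. Counting in eight blocks keeps each evaluation small. -/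
def blockCount (q : ℕ) : ℕ := ∑ s ∈ range 8, popCount 32 (2 ^ 15) (solutions (8 * q + s))

theorem blockCount_zero : blockCount 0 = 210468 := by decide +kernel

theorem blockCount_one : blockCount 1 = 210468 := by decide +kernel

theorem blockCount_two : blockCount 2 = 155490 := by decide +kernel

theorem blockCount_three : blockCount 3 = 155490 := by decide +kernel

theorem blockCount_four : blockCount 4 = 155490 := by decide +kernel

theorem blockCount_five : blockCount 5 = 155490 := by decide +kernel

theorem blockCount_six : blockCount 6 = 210468 := by decide +kernel

theorem blockCount_seven : blockCount 7 = 210468 := by decide +kernel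

theorem _root_.Nat.card_subtype_lt_lt (K N : ℕ) (P : ℕ → ℕ → Bool) :
    Nat.card {q : ℕ × ℕ // q.1 < K ∧ q.2 < N ∧ P q.1 q.2 = true} =
      ∑ p ∈ range K, #{x ∈ range N | P p x = true} := by
  rw [Nat.subtype_card ((range K ×ˢ range N).filter fun q => P q.1 q.2 = true) (fun q => by
    rw [mem_filter, mem_product, mem_range, mem_range, and_assoc])]
  rw [card_filter, sum_product]
  exact sum_congr rfl fun p _ => (card_filter _ _).symm

theorem card_solutions :
    Nat.card {q : ℕ × ℕ // q.1 < 64 ∧ q.2 < 2 ^ 20 ∧ (solutions q.1).testBit q.2 = true} =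
      1463832 := by
  have h : ∀ p, #{x ∈ range (2 ^ 20) | (solutions p).testBit x = true} =
      popCount 32 (2 ^ 15) (solutions p) := by
    intro p
    rw [popCount_eq (by norm_num) (by norm_num)]
    norm_num
  rw [Nat.card_subtype_lt_lt 64 (2 ^ 20) fun p x => (solutions p).testBit x,
    sum_congr rfl fun p _ => h p, show 64 = 8 * 8 from rfl, sum_range_mul]
  change ∑ q ∈ range 8, blockCount q = _
  simp only [sum_range_succ, sum_range_zero, blockCount_zero, blockCount_one, blockCount_two,
    blockCount_three, blockCount_four, blockCount_five, blockCount_six, blockCount_seven]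

end WordTree

/-! ### The upper bounds -/

/-- The functions on the `5`-cube that satisfy `faceOK` on all `3`-faces. -/
def fiveCubeFunctions : Set (Finset (Fin 5) → Bool) :=
  {h | ∃ f : Finset ℕ → Bool, AllFacesOK 5 f ∧ ∀ A, h A = f (A.map Fin.valEmbedding)}

open WordTree in
/-- A function satisfying `faceOK` on all `3`-faces is determined by its values at the empty set and
at the singletons together with its normalization, which is one of the `1463832` solutions. -/
theorem card_fiveCubeFunctions_le : Nat.card fiveCubeFunctions ≤ 93685248 := by
  have hex : ∀ h : fiveCubeFunctions, ∃ f : Finset ℕ → Bool,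
      (∀ A, h.1 A = f (A.map Fin.valEmbedding)) ∧
      ∃ q : {q : ℕ × ℕ // q.1 < 64 ∧ q.2 < 2 ^ 20 ∧ (solutions q.1).testBit q.2 = true},
        Represents q.1.2 5 (normalized q.1.1) (removeAffine f) := by
    rintro ⟨h, f, hf, hA⟩
    obtain ⟨p, hp, x, hx, hr⟩ := exists_represents_normalized (removeAffine f)
      (removeAffine_empty f) (removeAffine_singleton f)
    have hb : (solutions p).testBit x = true := by
      have hones : (2 ^ 2 ^ 20 - 1 : ℕ).testBit x = true := by
        rw [Nat.testBit_two_pow_sub_one]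
        exact decide_eq_true hx
      unfold solutions
      exact testBit_word₀ hones hr hf.allFacesOK_removeAffine
    exact ⟨f, hA, ⟨(p, x), hp, hx, hb⟩, hr⟩
  choose f hA q hq using hex
  have hinj : Function.Injective fun h : fiveCubeFunctions =>
      ((f h ∅, fun i : Fin 5 => f h {(i : ℕ)}), q h) := by
    intro h h' he
    simp only [Prod.mk.injEq] at he
    obtain ⟨⟨h0, h1⟩, h2⟩ := he
    apply Subtype.ext
    funext A
    have hsub : A.map Fin.valEmbedding ⊆ range 5 := by
      intro i hi
      obtain ⟨j, -, rfl⟩ := mem_map.1 hi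
      exact mem_range.2 j.2
    have hr := hq h'
    rw [← h2] at hr
    have e1 := (hq h).eq hr hsub
    have e2 : affinePart (f h) (A.map Fin.valEmbedding) =
        affinePart (f h') (A.map Fin.valEmbedding) := by
      refine affinePart_congr h0 fun i hi => ?_
      exact congrFun h1 ⟨i, mem_range.1 (hsub hi)⟩
    rw [hA, hA]
    rw [removeAffine, removeAffine, e2] at e1
    exact Bool.xor_left_inj.1 e1
  have : Finite {q : ℕ × ℕ // q.1 < 64 ∧ q.2 < 2 ^ 20 ∧ (solutions q.1).testBit q.2 = true} :=
    Nat.finite_of_card_ne_zero (by rw [card_solutions]; norm_num)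
  have h := Nat.card_le_card_of_injective _ hinj
  rw [Nat.card_prod, Nat.card_prod, Nat.card_fun, card_solutions] at h
  simpa using h

/-- The potential of an odd unique sink orientation satisfies `faceOK` on every `3`-face: antipodal
vertices of the face must have different outmaps in the face. -/
theorem faceOK_of_isOddUSO {m : ℕ} {F : Finset (Fin m) → Bool} (hF : IsOddUSO (potentialOutmap F))
    {i j k : Fin m} (hij : i < j) (hjk : j < k) {X : Finset (Fin m)} (hi : i ∉ X) (hj : j ∉ X)
    (hk : k ∉ X) :
    faceOK (F X) (F (insert i X)) (F (insert j X)) (F (insert k X)) (F (insert i (insert j X)))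
      (F (insert i (insert k X))) (F (insert j (insert k X)))
      (F (insert i (insert j (insert k X)))) = true := by
  have hik := hij.trans hjk
  have hD : X ∆ insert i (insert j (insert k X)) = {i, j, k} := by
    ext l
    simp only [mem_symmDiff, mem_insert, mem_singleton]
    grind
  have hne : X ≠ insert i (insert j (insert k X)) := by
    intro h
    rw [← h, symmDiff_self] at hD
    exact insert_ne_empty i {j, k} hD.symm
  have h := (hF _ _ hne).1
  have fi : ({l ∈ ({i, j, k} : Finset (Fin m)) | i ≤ l}) = {i, j, k} := by
    ext l; simp only [mem_filter, mem_insert, mem_singleton]; grind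
  have fj : ({l ∈ ({i, j, k} : Finset (Fin m)) | j ≤ l}) = {j, k} := by
    ext l; simp only [mem_filter, mem_insert, mem_singleton]; grind
  have fk : ({l ∈ ({i, j, k} : Finset (Fin m)) | k ≤ l}) = {k} := by
    ext l; simp only [mem_filter, mem_insert, mem_singleton]; grind
  have ci : #({i, j, k} : Finset (Fin m)) = 3 :=
    card_eq_three.2 ⟨i, j, k, hij.ne, hik.ne, hjk.ne, rfl⟩
  have cj : #({j, k} : Finset (Fin m)) = 2 := card_pair hjk.ne
  have ei : X ∆ {i} = insert i X := by
    ext l; simp only [mem_symmDiff, mem_insert, mem_singleton]; grind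
  have ej : X ∆ {j} = insert j X := by
    ext l; simp only [mem_symmDiff, mem_insert, mem_singleton]; grind
  have ek : X ∆ {k} = insert k X := by
    ext l; simp only [mem_symmDiff, mem_insert, mem_singleton]; grind
  have ei' : insert i (insert j (insert k X)) ∆ {i} = insert j (insert k X) := by
    ext l; simp only [mem_symmDiff, mem_insert, mem_singleton]; grind
  have ej' : insert i (insert j (insert k X)) ∆ {j} = insert i (insert k X) := by
    ext l; simp only [mem_symmDiff, mem_insert, mem_singleton]; grind
  have ek' : insert i (insert j (insert k X)) ∆ {k} = insert i (insert j X) := by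
    ext l; simp only [mem_symmDiff, mem_insert, mem_singleton]; grind
  have o3 : Odd 3 := by decide
  have o2 : ¬ Odd 2 := by decide
  rw [hD] at h
  simp only [disjoint_insert_left, disjoint_singleton_left, mem_potentialOutmap_symmDiff, hD, fi,
    fj, fk, ci, cj, card_singleton, ei, ej, ek, ei', ej', ek', o3, o2, odd_one] at h
  revert h
  unfold faceOK
  generalize F X = a, F (insert i X) = b, F (insert j X) = c, F (insert k X) = d,
    F (insert i (insert j X)) = e, F (insert i (insert k X)) = f,
    F (insert j (insert k X)) = g, F (insert i (insert j (insert k X))) = h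
  revert a b c d e f g h
  decide

/-- The potentials on the `(5 + r)`-cube are determined by their restrictions to `2 ^ r` parallel
`5`-faces. -/
theorem puso_add_six_le (r : ℕ) : puso (5 + r + 1) ≤ 93685248 ^ 2 ^ r := by
  -- the face of the large cube with free coordinates `0, …, 4` through `Z`
  let face : Finset (Fin r) → Finset ℕ → Finset (Fin (5 + r)) := fun Z Y =>
    {a | (a : ℕ) ∈ Y ∨ ∃ z ∈ Z, a = Fin.natAdd 5 z}
  have hface : ∀ (F : {F : Finset (Fin (5 + r)) → Bool // IsOddUSO (potentialOutmap F)})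
      (Z : Finset (Fin r)), AllFacesOK 5 fun Y => F.1 (face Z Y) := by
    intro F Z i j k Y hij hjk hk hY hi hj hk'
    have hins : ∀ (l : ℕ) (hl : l < 5) (T : Finset ℕ),
        face Z (insert l T) = insert ⟨l, by omega⟩ (face Z T) := by
      intro l hl T
      ext a
      simp only [face, mem_filter_univ, mem_insert, Fin.ext_iff]
      tauto
    have hmem : ∀ (l : ℕ) (hl : l < 5) (T : Finset ℕ), l ∉ T →
        (⟨l, by omega⟩ : Fin (5 + r)) ∉ face Z T := by
      intro l hl T hlT
      simp only [face, mem_filter_univ, Fin.ext_iff, Fin.val_natAdd]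
      rintro (h | ⟨z, -, h⟩)
      · exact hlT h
      · omega
    have := faceOK_of_isOddUSO F.2 (i := ⟨i, by omega⟩) (j := ⟨j, by omega⟩) (k := ⟨k, by omega⟩)
      (Fin.mk_lt_mk.2 hij) (Fin.mk_lt_mk.2 hjk) (hmem i (by omega) Y hi) (hmem j (by omega) Y hj)
      (hmem k hk Y hk')
    simpa only [hins i (by omega), hins j (by omega), hins k hk] using this
  have hinj : Function.Injective
      fun (F : {F : Finset (Fin (5 + r)) → Bool // IsOddUSO (potentialOutmap F)})
        (Z : Finset (Fin r)) => (⟨fun A => F.1 (face Z (A.map Fin.valEmbedding)),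
          fun Y => F.1 (face Z Y), hface F Z, fun _ => rfl⟩ : fiveCubeFunctions) := by
    intro F F' h
    apply Subtype.ext
    funext X
    have h' := congrFun (congrArg Subtype.val (congrFun h {z | Fin.natAdd 5 z ∈ X}))
      {i | Fin.castAdd r i ∈ X}
    have hX : face {z | Fin.natAdd 5 z ∈ X}
        (({i | Fin.castAdd r i ∈ X} : Finset (Fin 5)).map Fin.valEmbedding) = X := by
      ext a
      simp only [face, mem_filter_univ, mem_map, Fin.valEmbedding_apply]
      refine Fin.addCases (fun i => ?_) (fun z => ?_) a
      · constructor
        · rintro (⟨j, hj, hji⟩ | ⟨z, -, hz⟩)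
          · have : j = i := Fin.ext (by simpa using hji)
            exact this ▸ hj
          · have := congrArg Fin.val hz
            simp only [Fin.val_castAdd, Fin.val_natAdd] at this
            omega
        · intro hi
          exact Or.inl ⟨i, hi, rfl⟩
      · constructor
        · rintro (⟨j, -, hj⟩ | ⟨y, hy, hyz⟩)
          · simp only [Fin.val_natAdd] at hj
            omega
          · rwa [hyz]
        · intro hz
          exact Or.inr ⟨z, hz, rfl⟩
    dsimp only at h'
    rwa [hX] at h'
  have h := (puso_succ_le_card_potential (5 + r)).trans (Nat.card_le_card_of_injective _ hinj)
  rw [Nat.card_fun] at h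
  refine h.trans ((Nat.pow_le_pow_left card_fiveCubeFunctions_le _).trans_eq ?_)
  simp [Nat.card_eq_fintype_card]

theorem puso_lt_pow {n : ℕ} (hn : 6 ≤ n) : (puso n : ℝ) < (1.777128 : ℝ) ^ 2 ^ (n - 1) := by
  obtain ⟨r, rfl⟩ := Nat.exists_eq_add_of_le hn
  have h : puso (6 + r) ≤ 93685248 ^ 2 ^ r := by
    have := puso_add_six_le r
    rwa [show 5 + r + 1 = 6 + r by ring] at this
  have he : 2 ^ (6 + r - 1) = 32 * 2 ^ r := by
    rw [show 6 + r - 1 = 5 + r by omega, pow_add]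
    norm_num
  calc (puso (6 + r) : ℝ) ≤ (93685248 : ℝ) ^ 2 ^ r := by exact_mod_cast h
    _ < ((1.777128 : ℝ) ^ 32) ^ 2 ^ r :=
        pow_lt_pow_left₀ (by norm_num) (by norm_num) (by positivity)
    _ = (1.777128 : ℝ) ^ 2 ^ (6 + r - 1) := by rw [he, pow_mul]

/-! ### The lower bound -/

theorem card_filter_odd_card_le {α : Type*} [LinearOrder α] (D : Finset α) :
    #{i ∈ D | Odd #{j ∈ D | i ≤ j}} = (#D + 1) / 2 := by
  induction D using Finset.induction_on_min with
  | empty => simp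
  | insert a s ha ih =>
    have has : a ∉ s := fun h => lt_irrefl a (ha a h)
    have h1 : {j ∈ insert a s | a ≤ j} = insert a s := by
      refine filter_true_of_mem fun j hj => ?_
      rcases mem_insert.1 hj with rfl | hj
      · exact le_rfl
      · exact (ha j hj).le
    have h2 : {i ∈ s | Odd #{j ∈ insert a s | i ≤ j}} = {i ∈ s | Odd #{j ∈ s | i ≤ j}} := by
      refine filter_congr fun i hi => ?_
      rw [filter_insert, if_neg (ha i hi).not_ge]
    rw [filter_insert, h1, h2, card_insert_of_notMem has]
    split_ifs with h
    · rw [card_insert_of_notMem (fun h => has (mem_filter.1 h).1), ih]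
      obtain ⟨c, hc⟩ := h
      omega
    · rw [ih]
      rw [Nat.not_odd_iff_even] at h
      obtain ⟨c, hc⟩ := h
      omega

/-- Flipping all edges at the vertices of a set of minimum distance `3` turns the Klee–Minty
orientation into an odd unique sink orientation. For vertices `X`, `Y`, the coordinates of
`D = X ∆ Y` alternate between differing and agreeing in the Klee–Minty orientation. The flips negate
this pattern if exactly one of `X`, `Y` is in `S`, and change at most one more coordinate for each
of `X`, `Y` not in `S`; since `S` has minimum distance `3`, this is too little to make the pattern
constant, except possibly to make all coordinates differ when `#D` is odd. -/
theorem isOddUSO_potentialOutmap_indicator {m : ℕ} {S : Finset (Finset (Fin m))}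
    (hS : ∀ X ∈ S, ∀ Y ∈ S, X ≠ Y → 3 ≤ #(X ∆ Y)) :
    IsOddUSO (potentialOutmap fun X => decide (X ∈ S)) := by
  intro X Y hXY
  set D := X ∆ Y with hD
  have hDpos : 0 < #D := by
    rw [card_pos, Finset.nonempty_iff_ne_empty]
    intro h
    exact hXY (symmDiff_eq_bot.1 h)
  have hnear : ∀ V W, V ∈ S → W ∈ S → V ∆ W ≠ ∅ → 3 ≤ #(V ∆ W) := by
    intro V W hV hW h
    exact hS V hV W hW fun he => h (by rw [he]; exact symmDiff_self W)
  set E : Finset (Fin m) :=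
    {i ∈ D | (decide (X ∆ {i} ∈ S) ^^ decide (Y ∆ {i} ∈ S)) = true} with hE
  -- If the pattern is constant, the flipped coordinates in `D` form one of the alternating halves.
  suffices key : ∀ κ : Bool, (κ = (decide (X ∈ S) ^^ decide (Y ∈ S)) ∨ ¬ Odd #D) →
      (∀ i ∈ D, (i ∈ E ↔ (decide (Odd #{j ∈ D | i ≤ j}) ^^ κ) = true)) → False by
    constructor
    · intro hdis
      refine key _ (Or.inl rfl) fun i hi => ?_
      have h := Finset.disjoint_left.1 hdis hi
      rw [mem_potentialOutmap_symmDiff, ← hD] at h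
      rw [hE, mem_filter]
      simp only [hi, true_and]
      revert h
      generalize decide (X ∈ S) = a, decide (Y ∈ S) = b, decide (X ∆ {i} ∈ S) = c,
        decide (Y ∆ {i} ∈ S) = d, decide (Odd #{j ∈ D | i ≤ j}) = e
      revert a b c d e
      decide
    · intro hsub
      by_contra hodd
      refine key (!(decide (X ∈ S) ^^ decide (Y ∈ S))) (Or.inr hodd) fun i hi => ?_
      have h := hsub hi
      rw [mem_potentialOutmap_symmDiff, ← hD] at h
      rw [hE, mem_filter]
      simp only [hi, true_and]
      revert h
      generalize decide (X ∈ S) = a, decide (Y ∈ S) = b, decide (X ∆ {i} ∈ S) = c,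
        decide (Y ∆ {i} ∈ S) = d, decide (Odd #{j ∈ D | i ≤ j}) = e
      revert a b c d e
      decide
  intro κ hκ hpat
  have hED : E ⊆ D := filter_subset _ _
  have hcard : #E = if κ = true then #D / 2 else (#D + 1) / 2 := by
    have h1 := card_filter_odd_card_le D
    have h2 := card_filter_add_card_filter_not (s := D) fun i => Odd #{j ∈ D | i ≤ j}
    cases κ
    · have : E = {i ∈ D | Odd #{j ∈ D | i ≤ j}} := by
        ext i
        exact ⟨fun hi => mem_filter.2 ⟨hED hi, by simpa using (hpat i (hED hi)).1 hi⟩,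
          fun hi => (hpat i (mem_filter.1 hi).1).2 (by simpa using (mem_filter.1 hi).2)⟩
      rw [this, h1]
      rfl
    · have : E = {i ∈ D | ¬ Odd #{j ∈ D | i ≤ j}} := by
        ext i
        exact ⟨fun hi => mem_filter.2 ⟨hED hi, by simpa using (hpat i (hED hi)).1 hi⟩,
          fun hi => (hpat i (mem_filter.1 hi).1).2 (by simpa using (mem_filter.1 hi).2)⟩
      rw [this, if_pos rfl]
      omega
  have hEhalf : #D / 2 ≤ #E := by
    rw [hcard]
    split_ifs <;> omega
  have hYX : ∀ i, Y ∆ {i} = X ∆ (D ∆ {i}) := fun i => by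
    rw [hD, ← symmDiff_assoc, symmDiff_symmDiff_cancel_left]
  have hDi : ∀ i ∈ D, D ∆ {i} = D.erase i := by
    intro i hi
    ext l
    simp only [mem_symmDiff, mem_singleton, mem_erase]
    grind
  rcases lt_or_ge #D 3 with hlt | hge
  · obtain h1 | h2 : #D = 1 ∨ #D = 2 := by omega
    · obtain ⟨i, hi⟩ := card_eq_one.1 h1
      have hκ' := hκ.resolve_right (by rw [h1]; simp)
      have hmem := hpat i (by simp [hi])
      have hY : Y = X ∆ {i} := by rw [← hi, hD, symmDiff_symmDiff_cancel_left]
      have hX : Y ∆ {i} = X := by rw [hY, symmDiff_symmDiff_cancel_right]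
      rw [hE, mem_filter, hX, ← hY, hi, hκ'] at hmem
      simp only [mem_singleton, true_and, filter_singleton, le_refl, if_true, card_singleton,
        odd_one, decide_true] at hmem
      by_cases c1 : X ∈ S <;> by_cases c2 : Y ∈ S <;> simp [c1, c2] at hmem
    · obtain ⟨i, j, hij, hDij⟩ := card_eq_two.1 h2
      have hE1 : #E = 1 := by rw [hcard, h2]; split_ifs <;> rfl
      have hi : i ∈ D := by simp [hDij]
      have hj : j ∈ D := by simp [hDij]
      have e1 : Y ∆ {i} = X ∆ {j} := by
        rw [hYX, hDi i hi, hDij, erase_insert (by simpa using hij)]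
      have e2 : Y ∆ {j} = X ∆ {i} := by
        rw [hYX, hDi j hj, hDij, pair_comm, erase_insert (by simpa using hij.symm)]
      have hiff : i ∈ E ↔ j ∈ E := by
        rw [hE, mem_filter, mem_filter, e1, e2, Bool.xor_comm]
        simp only [hi, hj]
      obtain ⟨l, hl⟩ := card_eq_one.1 hE1
      have hlD : l ∈ D := hED (hl ▸ mem_singleton_self l)
      rw [hl, mem_singleton, mem_singleton] at hiff
      rw [hDij, mem_insert, mem_singleton] at hlD
      rcases hlD with rfl | rfl
      · exact hij (hiff.1 rfl).symm
      · exact hij (hiff.2 rfl)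
  · -- each vertex has at most one neighbour in `S`, and none if it is in `S` itself
    have huniq : ∀ V i j, V ∆ {i} ∈ S → V ∆ {j} ∈ S → i = j := by
      intro V i j hi hj
      by_contra hne
      have he : (V ∆ {i}) ∆ (V ∆ {j}) = {i, j} := by
        rw [symmDiff_comm V, symmDiff_assoc, symmDiff_symmDiff_cancel_left]
        ext l
        simp only [mem_symmDiff, mem_singleton, mem_insert]
        grind
      have := hnear _ _ hi hj (by rw [he]; exact insert_ne_empty _ _)
      rw [he, card_pair hne] at this
      omega
    have hself : ∀ V i, V ∈ S → V ∆ {i} ∉ S := by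
      intro V i hV hi
      have he : V ∆ (V ∆ {i}) = {i} := symmDiff_symmDiff_cancel_left V {i}
      have := hnear _ _ hV hi (by rw [he]; exact singleton_ne_empty i)
      rw [he, card_singleton] at this
      omega
    have hcross : ∀ V W i, V ∆ W = D → i ∈ D → V ∈ S → W ∆ {i} ∈ S → 3 ≤ #D - 1 := by
      intro V W i hVW hi hV hW
      have he : V ∆ (W ∆ {i}) = D.erase i := by rw [← symmDiff_assoc, hVW, hDi i hi]
      have := hnear _ _ hV hW (by
        rw [he, ← card_pos.trans Finset.nonempty_iff_ne_empty, card_erase_of_mem hi]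
        omega)
      rwa [he, card_erase_of_mem hi] at this
    -- if exactly one of the vertices is in `S`, only the other one contributes to `E`
    have hone : ∀ V W, V ∆ W = D → V ∈ S → W ∉ S →
        (∀ i ∈ E, W ∆ {i} ∈ S) → κ = true ∨ ¬ Odd #D → False := by
      intro V W hVW hV hW hEW hκ'
      have h1 : #E ≤ 1 := card_le_one.2 fun i hi j hj => huniq W i j (hEW i hi) (hEW j hj)
      have h3 : #D = 3 := by omega
      obtain ⟨i, hi⟩ := card_pos.1 (show 0 < #E by omega)
      have := hcross V W i hVW (hED hi) hV (hEW i hi)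
      omega
    have hmemE : ∀ i ∈ E, (decide (X ∆ {i} ∈ S) ^^ decide (Y ∆ {i} ∈ S)) = true :=
      fun i hi => (mem_filter.1 hi).2
    by_cases hX : X ∈ S <;> by_cases hY : Y ∈ S
    · obtain ⟨i, hi⟩ := card_pos.1 (show 0 < #E by omega)
      have := hmemE i hi
      simp [hself X i hX, hself Y i hY] at this
    · refine hone X Y rfl hX hY (fun i hi => ?_) (by simpa [hX, hY] using hκ)
      have := hmemE i hi
      simpa [hself X i hX] using this
    · refine hone Y X (symmDiff_comm Y X) hY hX (fun i hi => ?_) (by simpa [hX, hY] using hκ)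
      have := hmemE i hi
      simpa [hself Y i hY] using this
    · simp only [hX, hY, decide_false, Bool.xor_false] at hκ
      have hE2 : 2 ≤ #E := by
        rcases hκ with rfl | hev
        · rw [hcard, if_neg (by decide)]
          omega
        · have : #D ≠ 3 := fun h => hev (by rw [h]; decide)
          omega
      have hXle : #{i ∈ D | X ∆ {i} ∈ S} ≤ 1 := card_le_one.2 fun i hi j hj =>
        huniq X i j (mem_filter.1 hi).2 (mem_filter.1 hj).2
      have hYle : #{i ∈ D | Y ∆ {i} ∈ S} ≤ 1 := card_le_one.2 fun i hi j hj =>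
        huniq Y i j (mem_filter.1 hi).2 (mem_filter.1 hj).2
      have hEsub : E ⊆ {i ∈ D | X ∆ {i} ∈ S} ∪ {i ∈ D | Y ∆ {i} ∈ S} := by
        intro i hi
        have h1 := hmemE i hi
        have h2 := hED hi
        rw [mem_union, mem_filter, mem_filter]
        by_cases c : X ∆ {i} ∈ S
        · exact Or.inl ⟨h2, c⟩
        · exact Or.inr ⟨h2, by simpa [c] using h1⟩
      have hcardle := (card_le_card hEsub).trans (card_union_le _ _)
      obtain ⟨i, hi⟩ := card_pos.1 (show 0 < #{i ∈ D | X ∆ {i} ∈ S} by omega)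
      obtain ⟨j, hj⟩ := card_pos.1 (show 0 < #{i ∈ D | Y ∆ {i} ∈ S} by omega)
      have hij : i ≠ j := by
        rintro rfl
        have hsub : E ⊆ {i} := by
          intro l hl
          rw [mem_singleton]
          rcases mem_union.1 (hEsub hl) with h | h
          · exact huniq X l i (mem_filter.1 h).2 (mem_filter.1 hi).2
          · exact huniq Y l i (mem_filter.1 h).2 (mem_filter.1 hj).2
        have := card_le_card hsub
        rw [card_singleton] at this
        omega
      rw [mem_filter] at hi hj
      have he : (X ∆ {i}) ∆ (Y ∆ {j}) = (D.erase i).erase j := by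
        rw [symmDiff_symmDiff_symmDiff_comm, ← hD]
        ext l
        have hi' := hi.1
        have hj' := hj.1
        simp only [mem_symmDiff (s := D), mem_symmDiff (s := {i}), mem_singleton, mem_erase]
        grind
      have hce : #((D.erase i).erase j) = #D - 2 := by
        rw [card_erase_of_mem (mem_erase.2 ⟨hij.symm, hj.1⟩), card_erase_of_mem hi.1]
        omega
      have hD5 := hnear _ _ hi.2 hj.2 (by
        rw [he, ← card_pos.trans Finset.nonempty_iff_ne_empty, hce]
        omega)
      rw [he, hce] at hD5
      rcases hκ with rfl | hev
      · rw [if_neg (by decide)] at hcard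
        omega
      · have : #D ≠ 5 := fun h => hev (by rw [h]; decide)
        omega

/-- The Hamming code: the classes of the syndrome map, the sum of the vectors in `𝔽₂ᵏ ∖ {0}` indexed
by a set, have minimum distance `3`, and one of them has at least the average size. -/
theorem exists_code (k m : ℕ) (hm : m + 1 = 2 ^ k) : ∃ C : Finset (Finset (Fin m)),
    2 ^ (m - k) ≤ #C ∧ ∀ X ∈ C, ∀ Y ∈ C, X ≠ Y → 3 ≤ #(X ∆ Y) := by
  classical
  have hcard : Fintype.card {g : Fin k → ZMod 2 // g ≠ 0} = Fintype.card (Fin m) := by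
    rw [Fintype.card_subtype_compl, Fintype.card_subtype_eq]
    simp only [Fintype.card_pi, ZMod.card, prod_const, card_univ, Fintype.card_fin]
    omega
  let e := (Fintype.equivOfCardEq hcard).symm
  let s : Finset (Fin m) → (Fin k → ZMod 2) := fun X => ∑ i ∈ X, (e i).1
  have hk : k ≤ m := by
    have := Nat.lt_two_pow_self (n := k)
    omega
  obtain ⟨y, -, hy⟩ := exists_le_card_fiber_of_mul_le_card_of_maps_to
    (s := (univ : Finset (Finset (Fin m)))) (t := (univ : Finset (Fin k → ZMod 2))) (f := s)
    (n := 2 ^ (m - k)) (fun _ _ => mem_univ _) univ_nonempty (by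
      simp only [card_univ, Fintype.card_pi, ZMod.card, prod_const, Fintype.card_finset,
        Fintype.card_fin]
      rw [← pow_add, Nat.add_sub_cancel' hk])
  refine ⟨_, hy, fun X hX Y hY hXY => ?_⟩
  have hs : s X = s Y := by rw [(mem_filter.1 hX).2, (mem_filter.1 hY).2]
  have htwo : ∀ g : Fin k → ZMod 2, g + g = 0 := fun g => funext fun i => CharTwo.add_self_eq_zero _
  have hzero : ∑ i ∈ X ∆ Y, (e i).1 = 0 := by
    have h1 : ∑ i ∈ X ∆ Y, (e i).1 = ∑ i ∈ X \ Y, (e i).1 + ∑ i ∈ Y \ X, (e i).1 :=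
      sum_union disjoint_sdiff_sdiff
    have h2 := sum_inter_add_sum_sdiff X Y fun i => (e i).1
    have h3 := sum_inter_add_sum_sdiff Y X fun i => (e i).1
    rw [inter_comm] at h3
    have h4 : ∑ i ∈ X \ Y, (e i).1 = ∑ i ∈ Y \ X, (e i).1 :=
      add_left_cancel ((h2.trans hs).trans h3.symm)
    rw [h1, h4, htwo]
  by_contra! hlt
  have hpos : 0 < #(X ∆ Y) := by
    rw [card_pos, Finset.nonempty_iff_ne_empty]
    exact fun h => hXY (symmDiff_eq_bot.1 h)
  obtain h1 | h2 : #(X ∆ Y) = 1 ∨ #(X ∆ Y) = 2 := by omega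
  · obtain ⟨i, hi⟩ := card_eq_one.1 h1
    rw [hi, sum_singleton] at hzero
    exact (e i).2 hzero
  · obtain ⟨i, j, hij, h⟩ := card_eq_two.1 h2
    rw [h, sum_pair hij] at hzero
    refine hij (e.injective (Subtype.ext ?_))
    exact add_right_cancel (hzero.trans (htwo (e j).1).symm)

theorem two_pow_le_puso (k m : ℕ) (hk : k ≠ 0) (hm : m + 1 = 2 ^ k) :
    2 ^ (2 ^ (m - k) + 1) ≤ puso (m + 1) := by
  have hm0 : m ≠ 0 := by
    rintro rfl
    have := Nat.one_lt_two_pow hk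
    omega
  obtain ⟨C, hC, hdist⟩ := exists_code k m hm
  have hodd : ∀ S : C.powerset, IsOddUSO (potentialOutmap fun X => decide (X ∈ S.1)) := fun S =>
    isOddUSO_potentialOutmap_indicator fun X hX Y hY =>
      hdist X (mem_powerset.1 S.2 hX) Y (mem_powerset.1 S.2 hY)
  have hinj : Function.Injective fun S : C.powerset =>
      (⟨_, hodd S⟩ : {ψ : Finset (Fin m) → Finset (Fin m) // IsOddUSO ψ}) := by
    intro S T h
    have hST := congrArg Subtype.val h
    dsimp only at hST
    have i : Fin m := ⟨0, Nat.pos_of_ne_zero hm0⟩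
    apply Subtype.ext
    ext X
    -- the neighbours of a code word are no code words
    by_cases hX : X ∈ C
    · have hn : X ∆ {i} ∉ C := by
        intro hn
        have he : X ∆ (X ∆ {i}) = {i} := symmDiff_symmDiff_cancel_left X {i}
        have := hdist X hX _ hn fun h => by
          rw [← h, symmDiff_self] at he
          exact singleton_ne_empty i he.symm
        rw [he, card_singleton] at this
        omega
      have hS : X ∆ {i} ∉ S.1 := fun h => hn (mem_powerset.1 S.2 h)
      have hT : X ∆ {i} ∉ T.1 := fun h => hn (mem_powerset.1 T.2 h)
      have h1 : i ∈ potentialOutmap (fun X => decide (X ∈ S.1)) X ↔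
          i ∈ potentialOutmap (fun X => decide (X ∈ T.1)) X := by rw [hST]
      rw [mem_potentialOutmap, mem_potentialOutmap, decide_eq_false hS, decide_eq_false hT] at h1
      by_cases c1 : X ∈ S.1 <;> by_cases c2 : X ∈ T.1 <;>
        by_cases c3 : Odd #{j ∈ X | i ≤ j} <;> simp [c1, c2, c3] at h1 ⊢
    · exact iff_of_false (fun h => hX (mem_powerset.1 S.2 h)) fun h => hX (mem_powerset.1 T.2 h)
  have h := Nat.card_le_card_of_injective _ hinj
  rw [Nat.card_eq_fintype_card, Fintype.card_coe, card_powerset] at h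
  calc 2 ^ (2 ^ (m - k) + 1) = 2 * 2 ^ 2 ^ (m - k) := by rw [pow_succ, mul_comm]
    _ ≤ 2 * 2 ^ #C := Nat.mul_le_mul_left 2 (Nat.pow_le_pow_right (by norm_num) hC)
    _ ≤ _ := (Nat.mul_le_mul_left 2 h).trans (two_mul_card_le_puso_succ hm0)

theorem theorem7p1 :
    (∀ n : ℕ, 2 ≤ n → puso n ≤ 2 ^ (2 ^ (n - 1))) ∧
    (∀ n : ℕ, 6 ≤ n → (puso n : ℝ) < (1.777128 : ℝ) ^ (2 ^ (n - 1))) ∧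
    (∀ n k : ℕ, 2 ≤ k → n = 2 ^ k → 2 ^ (2 ^ (n - 1 - Nat.log 2 n) + 1) ≤ puso n) := by
  refine ⟨fun n hn => puso_le_two_pow (by omega), fun n hn => puso_lt_pow hn, ?_⟩
  rintro n k hk rfl
  obtain ⟨m, hm⟩ : ∃ m, 2 ^ k = m + 1 := Nat.exists_eq_succ_of_ne_zero (by positivity)
  rw [Nat.log_pow (by norm_num), hm, Nat.add_sub_cancel]
  exact two_pow_le_puso k m (by omega) hm.symm
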